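/- **Model.** Time is slotted. In slot $n$ a number $a_n\in\{0,1,2,\dots\}$ of requests arrives; request $i$ has $v_p(i)\ge 1$ prefill tokens, $v_d(i)\ge 1$ decode tokens and a feature $z(i)$ in a finite set. The sequences $(a_n)_n$ and $(v_p(i),v_d(i),z(i))_i$ are each i.i.d. and are independent of each other (the components of a triple may be dependent), with finite means $\lambda=\mathbb E[a_1]$, $m_p=\mathbb E[v_p(1)]$, $m_d=\mathbb E[v_d(1)]$, and $\mathbb E[v_d(1)^2]<\infty$. Fix a token budget $b\ge 1$ and integers $t_k\ge 1$ ($0\le k\le b$), the number of slots needed to process a batch of $k$ tokens. The state $X(n)$ consists of the remaining processing time $R(n)$ of the current batch and the list, in order of arrival, of the triples $(P_i(n),D_i(n),Z_i(n))$, $i\in\mathcal Q_n$: numbers of prefill and decode tokens not yet loaded into a batch, and feature, of each request present. A scheduling algorithm $\pi$ maps each state with $R=0$ to numbers $(\delta_i^p,\delta_i^d)_{i\in\mathcal Q}$ of loaded tokens such that $\delta_i^p\le P_i$, $\delta_i^d\le 1$, $\delta_i^d=0$ if $P_i>0$, and $b':=\sum_i(\delta_i^p+\delta_i^d)\le b$.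 If $R(n)=0$, the loaded tokens are subtracted from the $P_i,D_i$, requests with no decode tokens left are removed, and $R(n+1)=t_{b'}-1$; if $R(n)>0$, nothing is loaded and $R(n+1)=R(n)-1$. The requests that arrive in slot $n$ are then appended to the list. The chain starts in a fixed state in which every request present has at least one decode token left; its state space is the set of states that it visits with positive probability, and the requirements on $\pi$ are imposed at these states. The algorithm is *work-conserving* if $b'=\min\bigl(b,\sum_{i\in\mathcal Q}(P_i+\mathbf 1\{P_i=0\})\bigr)$ in every state with $R=0$. For integers $K_p,K_d\ge 1$ it is *$(K_p,K_d)$-FCFS* if prefill tokens are loaded only from the $K_p$ oldest requests with $P_i>0$, and decode tokens only from the $K_d$ oldest requests with $P_i=0$. **Theorem.** (a) If $\lambda(m_p+m_d)<b/t_b$, then under every work-conserving $(K_p,K_d)$-FCFS scheduling algorithm for which the chain is irreducible, the chain is positive recurrent. (b) If $\lambda(m_p+m_d)>b/t_b$, and $b/t_b$ is the maximal token processing rate, i.e. $k/t_k\le b/t_b$ for all $k\le b$, then under every scheduling algorithm $$\mathbb P\Bigl\{\lim_{n\to\infty}|X(n)|=\infty\Bigr\}=1,\qquad |X(n)|=\sum_{i\in\mathcal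 Q_n}(P_i(n)+D_i(n)).$$ -/

import Mathlib

open MeasureTheory ProbabilityTheory Filter
open scoped ENNReal

namespace LLMEngine

/-- A request that is present in the system: its numbers of unprocessed (not yet loaded) prefill
and decode tokens, and its feature. -/
@[ext] structure Request (F : Type*) where
  prefill : ℕ
  decode : ℕ
  feature : F

/-- A system state at the beginning of a slot: the remaining processing time of the current batch
and the list of the requests that have not departed, the oldest one first. -/
@[ext] structure State (F : Type*) where
  remaining : ℕ
  queue : List (Request F)

/-- The numbers of prefill and decode tokens of one request that are loaded into a batch. -/
structure Load where
  prefill : ℕ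
  decode : ℕ

/-- A (not necessarily feasible) batch selection rule: it maps a state to a load for every request
in its queue. Only its values at states with `remaining = 0` are used. -/
abbrev Policy (F : Type*) := (x : State F) → Fin x.queue.length → Load

variable {F Ω : Type*}

/-- Every request that is present still has at least one decode token. -/
def State.Valid (x : State F) : Prop := ∀ q ∈ x.queue, 1 ≤ q.decode

/-- The total number of unprocessed tokens. -/
def State.size (x : State F) : ℕ := (x.queue.map fun q => q.prefill + q.decode).sum

/-- The largest number of tokens that could be loaded if there were no token budget: all prefill
tokens of the requests in the prefill phase, one token of each request in the decode phase. -/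
def State.available (x : State F) : ℕ :=
  (x.queue.map fun q => q.prefill + if q.prefill = 0 then 1 else 0).sum

/-- The token load of the batch selected in state `x`. -/
def tokenLoad (π : Policy F) (x : State F) : ℕ := ∑ i, ((π x i).decode + (π x i).prefill)

/-- The queue after the batch selected in state `x` has been loaded: the loaded tokens are
subtracted and the requests without remaining decode tokens are removed. -/
def loadedQueue (π : Policy F) (x : State F) : List (Request F) :=
  (List.ofFn fun i : Fin x.queue.length =>
    ({ prefill := (x.queue.get i).prefill - (π x i).prefill
       decode := (x.queue.get i).decode - (π x i).decode
       feature := (x.queue.get i).feature } : Request F)).filter fun q => q.decode ≠ 0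

/-- One slot of the dynamics; `new` is the list of the requests that arrive in the slot, and
`t k` is the number of slots needed to process a batch with `k` tokens. -/
def step (t : ℕ → ℕ) (π : Policy F) (x : State F) (new : List (Request F)) : State F :=
  if x.remaining = 0 then
    { remaining := t (tokenLoad π x) - 1, queue := loadedQueue π x ++ new }
  else
    { remaining := x.remaining - 1, queue := x.queue ++ new }

/-- The requests that arrive in slot `n`. Slots and requests are numbered from `0`; there are
`a n` arrivals in slot `n`, and request `i` has `vp i` prefill tokens, `vd i` decode tokens and
feature `z i`. -/
def arrivals (a vp vd : ℕ → Ω → ℕ) (z : ℕ → Ω → F) (n : ℕ) (ω : Ω) : List (Request F) :=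
  (List.range (a n ω)).map fun j =>
    let i := (∑ k ∈ Finset.range n, a k ω) + j
    { prefill := vp i ω, decode := vd i ω, feature := z i ω }

/-- The chain of system states started at `x`. -/
def chain (t : ℕ → ℕ) (π : Policy F) (a vp vd : ℕ → Ω → ℕ) (z : ℕ → Ω → F) (x : State F) :
    ℕ → Ω → State F
  | 0, _ => x
  | n + 1, ω => step t π (chain t π a vp vd z x n ω) (arrivals a vp vd z n ω)

/-- The states that a family `X x` of processes (`X x` being the chain started at `x`) visits with
positive probability when it is started at `x₀`. -/
def stateSpace [MeasurableSpace Ω] (μ : Measure Ω) (X : State F → ℕ → Ω → State F)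
    (x₀ : State F) : Set (State F) :=
  {y | ∃ n, 0 < μ {ω | X x₀ n ω = y}}

/-- Any two states in `S` communicate. -/
def IsIrreducibleOn [MeasurableSpace Ω] (μ : Measure Ω) (X : State F → ℕ → Ω → State F)
    (S : Set (State F)) : Prop :=
  ∀ x ∈ S, ∀ y ∈ S, ∃ n, 0 < μ {ω | X x n ω = y}

/-- The time of the first return to `x` of the chain started at `x` (`∞` if there is none). -/
noncomputable def returnTime (X : State F → ℕ → Ω → State F) (x : State F) (ω : Ω) : ℝ≥0∞ :=
  ⨅ (n : ℕ) (_ : 1 ≤ n ∧ X x n ω = x), (n : ℝ≥0∞)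

/-- Every state in `S` has a finite expected return time. -/
def IsPositiveRecurrentOn [MeasurableSpace Ω] (μ : Measure Ω) (X : State F → ℕ → Ω → State F)
    (S : Set (State F)) : Prop :=
  ∀ x ∈ S, ∫⁻ ω, returnTime X x ω ∂μ < ∞

/-- `π` is a scheduling algorithm with token budget `b` on the state space `S`: its batches are
feasible. -/
def IsSchedulingAlgorithm (b : ℕ) (π : Policy F) (S : Set (State F)) : Prop :=
  ∀ x ∈ S, x.remaining = 0 →
    (∀ i : Fin x.queue.length,
      (0 < (x.queue.get i).prefill → (π x i).decode = 0) ∧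
      (π x i).prefill ≤ (x.queue.get i).prefill ∧
      (π x i).decode ≤ 1) ∧
    tokenLoad π x ≤ b

/-- `π` never wastes token budget: its batch is full whenever `b` tokens are available, and
contains all the available tokens if there are fewer. -/
def IsWorkConserving (b : ℕ) (π : Policy F) (S : Set (State F)) : Prop :=
  ∀ x ∈ S, x.remaining = 0 → tokenLoad π x = min b x.available

/-- Prefill tokens are loaded only from the `Kp` oldest requests in the prefill phase, decode
tokens only from the `Kd` oldest requests in the decode phase. -/
def IsFCFS (Kp Kd : ℕ) (π : Policy F) (S : Set (State F)) : Prop :=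
  ∀ x ∈ S, x.remaining = 0 → ∀ i : Fin x.queue.length,
    (0 < (π x i).prefill →
      (Finset.univ.filter fun j => j < i ∧ 0 < (x.queue.get j).prefill).card < Kp) ∧
    (0 < (π x i).decode →
      (Finset.univ.filter fun j => j < i ∧ (x.queue.get j).prefill = 0).card < Kd)

end LLMEngine

/-!
Both parts compare the chain with a process that has a deterministic drift.

For (a), a batch that is not full contains every available token, so it advances each request by
one batch. Let `H` be the number of batches that a request can still stretch over in this way, and
put `V = ∑ i, (h * (P i + D i) + H i ^ 2) + c * R`. A full batch lowers the linear term by `h * b`,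
which pays for the `c * t b` added by its processing time as soon as `c ≤ h * (b / t b)`. A batch
that is not full lowers the sum of the squares by at least `∑ i, D i`, which is large unless the
state belongs to a finite set. In both cases each slot takes off `c`, and by Wald's identity the
arrivals of a slot add at most `h * λ * (m_p + m_d) + λ * E[(v_d + 1) ^ 2]` on average. Since
`λ * (m_p + m_d) < b / t b`, some `h` and `c` leave a negative drift outside a finite set, and
Foster's criterion applies.

Foster's criterion itself follows by correcting `V` on the finite set with a multiple of the
truncated expected return time `∑ k < N, P(no visit to the target at times 1, …, k)`: the sum
drops by `1 - P(no visit up to time N)` in each step before the visit, uniformly on the finite set.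

For (b), the sum of `|X n|` and `ρ` times the remaining processing time loses at most `ρ` in each
slot, where `ρ` bounds the token processing rate. Hence `|X n|` is at least the number of tokens
that have arrived minus `ρ * n` and a constant, and the strong law of large numbers applies.
-/

namespace LLMEngine

section Independence

variable {Ω E G : Type*} [MeasurableSpace Ω] {μ : Measure Ω} [MeasurableSpace E]
  [MeasurableSpace G]

lemma lintegral_comp_prodMk_of_indepFun [IsFiniteMeasure μ] {X : Ω → E} {Y : Ω → G}
    (hX : Measurable X) (hY : Measurable Y) (hXY : IndepFun X Y μ) {g : E × G → ℝ≥0∞}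
    (hg : Measurable g) :
    ∫⁻ ω, g (X ω, Y ω) ∂μ = ∫⁻ ω, ∫⁻ y, g (X ω, y) ∂μ.map Y ∂μ := by
  rw [← lintegral_map hg (hX.prodMk hY),
    (indepFun_iff_map_prod_eq_prod_map_map hX.aemeasurable hY.aemeasurable).1 hXY,
    lintegral_prod _ hg.aemeasurable, lintegral_map hg.lintegral_prod_right' hX]

/-- Wald's identity. -/
lemma lintegral_sum_range_of_indepFun [IsFiniteMeasure μ] {N : Ω → ℕ} {W : ℕ → Ω → ℝ≥0∞}
    {m : ℝ≥0∞} (hN : Measurable N) (hW : ∀ i, Measurable (W i))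
    (hNW : IndepFun N (fun ω i => W i ω) μ) (hm : ∀ i, ∫⁻ ω, W i ω ∂μ = m) :
    ∫⁻ ω, ∑ i ∈ Finset.range (N ω), W i ω ∂μ = (∫⁻ ω, N ω ∂μ) * m := by
  have hsum (n : ℕ) : Measurable fun w : ℕ → ℝ≥0∞ => ∑ i ∈ Finset.range n, w i := by fun_prop
  have hn (n : ℕ) : ∫⁻ w, ∑ i ∈ Finset.range n, w i ∂μ.map (fun ω i => W i ω) = n * m := by
    rw [lintegral_map (hsum n) (measurable_pi_lambda _ hW), lintegral_finsetSum _ fun i _ => hW i]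
    simp [hm]
  rw [lintegral_comp_prodMk_of_indepFun (g := fun p => ∑ i ∈ Finset.range p.1, p.2 i) hN
    (measurable_pi_lambda _ hW) hNW (measurable_from_prod_countable_right hsum)]
  simp only [hn]
  exact lintegral_mul_const _ (measurable_from_nat.comp hN)

end Independence

section IID

/-- The sequence `Y` of random variables is i.i.d. with law `ν`. -/
structure IsIID {Ω E : Type*} [MeasurableSpace Ω] [MeasurableSpace E] (Y : ℕ → Ω → E)
    (ν : Measure E) (μ : Measure Ω) : Prop where
  iIndepFun : iIndepFun Y μ
  hasLaw : ∀ n, HasLaw (Y n) ν μ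

/-- The first `n` values of the sequence `V`, as a list. -/
def history {Ω E : Type*} (V : ℕ → Ω → E) (n : ℕ) (ω : Ω) : List E :=
  (List.range n).map fun i => V i ω

/-- The sequence `V` cut into consecutive blocks of lengths `a 0, a 1, …`. -/
def blocks {Ω E : Type*} (a : ℕ → Ω → ℕ) (V : ℕ → Ω → E) (n : ℕ) (ω : Ω) : List E :=
  history (fun j => V ((∑ k ∈ Finset.range n, a k ω) + j)) (a n ω) ω

lemma isIID_of_identDistrib {Ω E : Type*} [MeasurableSpace Ω] [MeasurableSpace E] {Y : ℕ → Ω → E}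
    {μ : Measure Ω} (hY : iIndepFun Y μ) (hY_ident : ∀ n, IdentDistrib (Y n) (Y 0) μ μ) :
    IsIID Y (μ.map (Y 0)) μ :=
  ⟨hY, fun n => ⟨(hY_ident n).aemeasurable_fst, (hY_ident n).map_eq⟩⟩

section Lists

variable {Ω E : Type*} (V : ℕ → Ω → E) (a : ℕ → Ω → ℕ) (ω : Ω)

lemma history_add (m k : ℕ) :
    history V (m + k) ω = history V m ω ++ history (fun j => V (m + j)) k ω := by
  simp [history, List.range_add, Function.comp_def]

lemma sum_map_history {M : Type*} [AddCommMonoid M] (g : E → M) (n : ℕ) :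
    ((history V n ω).map g).sum = ∑ k ∈ Finset.range n, g (V k ω) := by
  rw [history, List.map_map, ← Multiset.sum_coe]
  rfl

lemma history_eq_ofFn_iff {n : ℕ} (f : Fin n → E) :
    history V n ω = List.ofFn f ↔ (fun i : Fin n => V i ω) = f := by
  simp [List.ext_get_iff, funext_iff, Fin.forall_iff, history]

lemma map_length_history_blocks (n : ℕ) :
    (history (blocks a V) n ω).map List.length = history a n ω := by
  simp [history, blocks, Function.comp_def]

lemma flatten_history_blocks (n : ℕ) :
    (history (blocks a V) n ω).flatten = history V (∑ k ∈ Finset.range n, a k ω) ω := by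
  induction n with
  | zero => simp [history]
  | succ n ih =>
    rw [history_add, List.flatten_append, ih, Finset.sum_range_succ, history_add]
    simp [history, blocks]

lemma history_blocks_eq_iff (hs : List (List E)) :
    history (blocks a V) hs.length ω = hs ↔
      history a hs.length ω = hs.map List.length ∧
        history V hs.flatten.length ω = hs.flatten := by
  rw [List.eq_iff_flatten_eq, flatten_history_blocks, map_length_history_blocks, and_comm]
  refine and_congr_right fun h => ?_
  have hsum : ∑ k ∈ Finset.range hs.length, a k ω = hs.flatten.length := by
    simpa [List.length_flatten, ← h] using (sum_map_history a ω id hs.length).symm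
  rw [hsum]

end Lists

end IID

lemma lintegral_sum_map_history {Ω E : Type*} [MeasurableSpace Ω] {μ : Measure Ω}
    [IsFiniteMeasure μ] [MeasurableSpace E] {N : Ω → ℕ} {V : ℕ → Ω → E} {ν : Measure E}
    (hN : Measurable N) (hV : ∀ i, Measurable (V i)) (hV_law : ∀ i, HasLaw (V i) ν μ)
    (hNV : IndepFun N (fun ω i => V i ω) μ) {g : E → ℝ≥0∞} (hg : Measurable g) :
    ∫⁻ ω, ((history V (N ω) ω).map g).sum ∂μ = (∫⁻ ω, N ω ∂μ) * ∫⁻ y, g y ∂ν := by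
  simp only [history, List.map_map]
  refine lintegral_sum_range_of_indepFun (W := fun i ω => g (V i ω)) hN (fun i => hg.comp (hV i))
    (hNV.comp (φ := id) (ψ := fun (s : ℕ → E) i => g (s i)) measurable_id
      (measurable_pi_lambda _ fun i => hg.comp (measurable_pi_apply i))) fun i => ?_
  exact (hV_law i).lintegral_comp hg.aemeasurable

local instance {E : Type*} : MeasurableSpace (List E) := ⊤

local instance {E : Type*} : DiscreteMeasurableSpace (List E) := ⟨fun _ => trivial⟩

section Blocks

variable {Ω E : Type*} [MeasurableSpace Ω] {μ : Measure Ω} [MeasurableSpace E]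
  [MeasurableSingletonClass E]

lemma measurable_history [Countable E] {V : ℕ → Ω → E} (hV : ∀ n, Measurable (V n)) (n : ℕ) :
    Measurable (history V n) := by
  have hofFn : history V n = List.ofFn ∘ fun ω (i : Fin n) => V i ω :=
    funext fun ω => (history_eq_ofFn_iff V ω _).2 rfl
  rw [hofFn]
  exact (measurable_of_countable _).comp (measurable_pi_lambda _ fun i => hV i)

lemma measurable_blocks [Countable E] {a : ℕ → Ω → ℕ} {V : ℕ → Ω → E}
    (ha : ∀ n, Measurable (a n)) (hV : ∀ n, Measurable (V n)) (n : ℕ) :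
    Measurable (blocks a V n) := by
  have hcut : Measurable fun p : (ℕ × ℕ) × Ω => history (fun j => V (p.1.1 + j)) p.1.2 p.2 :=
    measurable_from_prod_countable_right fun k => measurable_history (fun j => hV (k.1 + j)) k.2
  exact hcut.comp (f := fun ω => ((∑ k ∈ Finset.range n, a k ω, a n ω), ω)) (by fun_prop)

variable {ν : Measure E} [IsProbabilityMeasure ν]

lemma IsIID.measure_history_eq {V : ℕ → Ω → E} (hV : IsIID V ν μ) (l : List E) :
    μ {ω | history V l.length ω = l} = (l.map fun y => ν {y}).prod := by
  obtain ⟨n, f, rfl⟩ := List.exists_iff_exists_tuple.1 ⟨l, rfl⟩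
  have hpi : HasLaw (fun ω (i : Fin n) => V i ω) (Measure.pi fun _ => ν) μ :=
    (hV.iIndepFun.precomp Fin.val_injective).hasLaw_pi fun i => hV.hasLaw i
  simp only [List.length_ofFn, history_eq_ofFn_iff, List.map_ofFn, List.prod_ofFn]
  rw [hpi.measure_eq (p := fun g => g = f) (measurableSet_singleton f), Set.ofPred_eq_eq_singleton,
    Measure.pi_singleton]
  rfl

lemma isIID_of_measure_history_eq [Countable E] {V : ℕ → Ω → E} (hV : ∀ n, Measurable (V n))
    (h : ∀ l : List E, μ {ω | history V l.length ω = l} = (l.map fun y => ν {y}).prod) :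
    IsIID V ν μ := by
  have : IsProbabilityMeasure μ := ⟨by simpa [history] using h []⟩
  have hpi (n : ℕ) : HasLaw (fun ω (i : Fin n) => V i ω) (Measure.pi fun _ => ν) μ := by
    have hVn : Measurable fun ω (i : Fin n) => V i ω := measurable_pi_lambda _ fun i => hV i
    refine ⟨hVn.aemeasurable, Measure.ext_of_singleton fun f => ?_⟩
    have hf := h (List.ofFn f)
    simp only [List.length_ofFn, history_eq_ofFn_iff, List.map_ofFn, List.prod_ofFn] at hf
    rw [Measure.map_apply hVn (measurableSet_singleton f), Measure.pi_singleton]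
    exact hf
  have hlaw (n : ℕ) : HasLaw (V n) ν μ :=
    (measurePreserving_eval _ (Fin.last n)).hasLaw.comp (hpi (n + 1))
  refine ⟨iIndepFun_iff_finset.2 fun s => ?_, hlaw⟩
  have hs (i : s) : (i : ℕ) < s.sup id + 1 := Nat.lt_succ_of_le (Finset.le_sup (f := id) i.2)
  have := (iIndepFun_iff_hasLaw_pi_pi fun i : Fin (s.sup id + 1) => hlaw i).2 (hpi _)
  exact this.precomp (g := fun i : s => ⟨i, hs i⟩) fun i j hij => Subtype.ext (by simpa using hij)

theorem isIID_blocks [Countable E] {a : ℕ → Ω → ℕ} {V : ℕ → Ω → E} {α : Measure ℕ}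
    [IsProbabilityMeasure α] (ha : IsIID a α μ) (hV : IsIID V ν μ)
    (ha_meas : ∀ n, Measurable (a n)) (hV_meas : ∀ n, Measurable (V n))
    (haV : IndepFun (fun ω n => a n ω) (fun ω i => V i ω) μ) :
    IsIID (blocks a V) (μ.map (blocks a V 0)) μ := by
  have hb := measurable_blocks ha_meas hV_meas
  have := (ha.hasLaw 0).isProbabilityMeasure
  have := Measure.isProbabilityMeasure_map (μ := μ) (hb 0).aemeasurable
  have hlaw (hs : List (List E)) : μ {ω | history (blocks a V) hs.length ω = hs} =
      (hs.map fun l => α {l.length} * (l.map fun y => ν {y}).prod).prod := by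
    have hlen := ha.measure_history_eq (hs.map List.length)
    rw [List.length_map] at hlen
    simp only [history_blocks_eq_iff]
    refine (haV.measure_inter_preimage_eq_mul
      {s | history (fun n s => s n) hs.length s = hs.map List.length}
      {s | history (fun n s => s n) hs.flatten.length s = hs.flatten}
      (measurable_history measurable_pi_apply _ (measurableSet_singleton _))
      (measurable_history measurable_pi_apply _ (measurableSet_singleton _))).trans ?_
    refine (congrArg₂ (· * ·) hlen (hV.measure_history_eq hs.flatten)).trans ?_
    simp [List.prod_map_mul, List.map_flatten, List.prod_flatten, Function.comp_def]
  have hzero (l : List E) : μ.map (blocks a V 0) {l} =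
      α {l.length} * (l.map fun y => ν {y}).prod := by
    rw [Measure.map_apply (hb 0) (measurableSet_singleton l)]
    change μ {ω | blocks a V 0 ω = l} = _
    simpa [history] using hlaw [l]
  refine isIID_of_measure_history_eq hb fun hs => ?_
  simp only [hlaw, hzero]

end Blocks

section Kernel

variable {S : Type*} [MeasurableSpace S]

/-- The probability that a chain with transition kernel `κ` started at a given state avoids `A` at
the times `1, …, n`; time `0` does not count, so that the case of a single state `A` describes
return times. -/
noncomputable def avoidProb (κ : Kernel S S) (A : Set S) : ℕ → S → ℝ≥0∞
  | 0, _ => 1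
  | n + 1, x => ∫⁻ y in Aᶜ, avoidProb κ A n y ∂κ x

variable {κ : Kernel S S} {A : Set S}

lemma measurable_avoidProb [IsSFiniteKernel κ] (hA : MeasurableSet A) (n : ℕ) :
    Measurable (avoidProb κ A n) := by
  induction n with
  | zero => exact measurable_const
  | succ n ih => exact ih.setLIntegral_kernel hA.compl

lemma setLIntegral_sum_avoidProb_add_one [IsSFiniteKernel κ] (hA : MeasurableSet A) (N : ℕ)
    (x : S) :
    ∫⁻ y in Aᶜ, ∑ k ∈ Finset.range N, avoidProb κ A k y ∂κ x + 1 =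
      ∑ k ∈ Finset.range N, avoidProb κ A k x + avoidProb κ A N x := by
  rw [lintegral_finsetSum _ fun k _ => measurable_avoidProb hA k, ← Finset.sum_range_succ,
    Finset.sum_range_succ']
  rfl

variable [IsMarkovKernel κ]

lemma avoidProb_le_one (n : ℕ) (x : S) : avoidProb κ A n x ≤ 1 := by
  induction n generalizing x with
  | zero => exact le_rfl
  | succ n ih =>
    calc ∫⁻ y in Aᶜ, avoidProb κ A n y ∂κ x
      _ ≤ ∫⁻ _ in Aᶜ, 1 ∂κ x := lintegral_mono ih
      _ ≤ 1 := by simpa using prob_le_one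

lemma avoidProb_antitone (x : S) : Antitone fun n => avoidProb κ A n x := by
  refine antitone_nat_of_succ_le fun n => ?_
  induction n generalizing x with
  | zero => exact avoidProb_le_one 1 x
  | succ n ih => exact lintegral_mono ih

lemma avoidProb_succ_lt_one (hA : MeasurableSet A) {n : ℕ} {x z : S} (hz : κ x {z} ≠ 0)
    (h : z ∈ A ∨ avoidProb κ A n z < 1) : avoidProb κ A (n + 1) x < 1 := by
  have hle (y : S) : Aᶜ.indicator (avoidProb κ A n) y ≤ 1 :=
    Set.indicator_le' (fun y _ => avoidProb_le_one n y) (fun _ _ => zero_le) y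
  have hlt : Aᶜ.indicator (avoidProb κ A n) z ≠ 1 := by
    by_cases hzA : z ∈ A
    · simp [hzA]
    · simpa [hzA] using (h.resolve_left hzA).ne
  have hfreq : ∃ᵐ y ∂κ x, Aᶜ.indicator (avoidProb κ A n) y ≠ 1 :=
    frequently_ae_iff.2 fun h0 => hz (measure_mono_null (by simpa using hlt) h0)
  calc ∫⁻ y in Aᶜ, avoidProb κ A n y ∂κ x
    _ = ∫⁻ y, Aᶜ.indicator (avoidProb κ A n) y ∂κ x := (lintegral_indicator hA.compl _).symm
    _ < ∫⁻ _, 1 ∂κ x := by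
      refine lintegral_strict_mono_of_ae_le_of_frequently_ae_lt aemeasurable_const ?_
        (ae_of_all _ hle) hfreq
      exact ne_top_of_le_ne_top ENNReal.one_ne_top ((lintegral_mono hle).trans (by simp))
    _ = 1 := by simp

lemma exists_avoidProb_le_of_finite {C : Set S} (hC : C.Finite)
    (h : ∀ x ∈ C, ∃ n, avoidProb κ A n x < 1) : ∃ N, ∃ θ < 1, ∀ x ∈ C, avoidProb κ A N x ≤ θ := by
  have hN : ∀ x ∈ C, ∀ᶠ N in atTop, avoidProb κ A N x < 1 := fun x hx => by
    obtain ⟨n, hn⟩ := h x hx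
    exact eventually_atTop.2 ⟨n, fun N hN => (avoidProb_antitone x hN).trans_lt hn⟩
  obtain ⟨N, hN⟩ := (hC.eventually_all.2 hN).exists
  refine ⟨N, hC.toFinset.sup (avoidProb κ A N), ?_, fun x hx => ?_⟩
  · exact (Finset.sup_lt_iff (by simp)).2 fun x hx => hN x (hC.mem_toFinset.1 hx)
  · exact Finset.le_sup (f := avoidProb κ A N) (hC.mem_toFinset.2 hx)

lemma setLIntegral_sum_avoidProb_add_le (hA : MeasurableSet A) {N : ℕ} {x : S} {θ : ℝ≥0∞}
    (hθ : θ ≤ 1) (hx : avoidProb κ A N x ≤ θ) :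
    ∫⁻ y in Aᶜ, ∑ k ∈ Finset.range N, avoidProb κ A k y ∂κ x + (1 - θ) ≤
      ∑ k ∈ Finset.range N, avoidProb κ A k x := by
  refine (ENNReal.add_le_add_iff_right (ne_top_of_le_ne_top ENNReal.one_ne_top hθ)).1 ?_
  rw [add_assoc, tsub_add_cancel_of_le hθ, setLIntegral_sum_avoidProb_add_one hA]
  gcongr

lemma sum_avoidProb_le (hA : MeasurableSet A) {T : Set S} (hT : ∀ x ∈ T, ∀ᵐ y ∂κ x, y ∈ T)
    {W : S → ℝ≥0∞} (hW : ∀ x ∈ T, ∫⁻ y in Aᶜ, W y ∂κ x + 1 ≤ W x) (n : ℕ) {x : S} (hx : x ∈ T) :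
    ∑ k ∈ Finset.range n, avoidProb κ A k x ≤ W x := by
  induction n generalizing x with
  | zero => simp
  | succ n ih =>
    calc ∑ k ∈ Finset.range (n + 1), avoidProb κ A k x
      _ = ∫⁻ y in Aᶜ, ∑ k ∈ Finset.range n, avoidProb κ A k y ∂κ x + 1 := by
        rw [setLIntegral_sum_avoidProb_add_one hA, Finset.sum_range_succ]
      _ ≤ ∫⁻ y in Aᶜ, W y ∂κ x + 1 := by
        gcongr 1
        exact lintegral_mono_ae (ae_restrict_of_ae ((hT x hx).mono fun y hy => ih hy))
      _ ≤ W x := hW x hx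

/-- The witness is a multiple of the expected time to reach `A`, truncated at a fixed horizon. -/
lemma exists_setLIntegral_add_indicator_le (hA : MeasurableSet A) {C : Set S} (hC : C.Finite)
    (hreach : ∀ x ∈ C, ∃ n, avoidProb κ A n x < 1) {K : ℝ≥0∞} (hK : K ≠ ∞) :
    ∃ w : S → ℝ≥0∞, (∀ x, w x ≠ ∞) ∧ ∀ x,
      ∫⁻ y in Aᶜ, w y ∂κ x + C.indicator (fun _ => K) x ≤ w x := by
  obtain ⟨N, θ, hθ1, hθ⟩ := exists_avoidProb_le_of_finite hC hreach
  have hε0 : 1 - θ ≠ 0 := (tsub_pos_of_lt hθ1).ne'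
  have hε_top : 1 - θ ≠ ∞ := ne_top_of_le_ne_top ENNReal.one_ne_top tsub_le_self
  set r : ℝ≥0∞ := K / (1 - θ)
  have hsum_meas : Measurable fun y => ∑ k ∈ Finset.range N, avoidProb κ A k y :=
    Finset.measurable_fun_sum _ fun k _ => measurable_avoidProb hA k
  refine ⟨fun x => r * ∑ k ∈ Finset.range N, avoidProb κ A k x,
    fun x => ENNReal.mul_ne_top (ENNReal.div_ne_top hK hε0) (ENNReal.sum_ne_top.2 fun k _ =>
      ne_top_of_le_ne_top ENNReal.one_ne_top (avoidProb_le_one k x)), fun x => ?_⟩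
  beta_reduce
  rw [lintegral_const_mul r hsum_meas]
  by_cases hx : x ∈ C
  · have hKr : K = r * (1 - θ) := (ENNReal.div_mul_cancel hε0 hε_top).symm
    rw [Set.indicator_of_mem hx, hKr, ← mul_add]
    gcongr
    exact setLIntegral_sum_avoidProb_add_le hA hθ1.le (hθ x hx)
  · rw [Set.indicator_of_notMem hx, add_zero]
    gcongr
    simpa using setLIntegral_sum_avoidProb_add_le hA le_rfl (avoidProb_le_one N x)

theorem tsum_avoidProb_lt_top (hA : MeasurableSet A) {T : Set S}
    (hT : ∀ x ∈ T, ∀ᵐ y ∂κ x, y ∈ T) {V : S → ℝ≥0∞} (hV : Measurable V) (hV_top : ∀ x, V x ≠ ∞)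
    {C : Set S} (hC : C.Finite) {K : ℝ≥0∞} (hK : K ≠ ∞)
    (hdrift : ∀ x ∈ T, ∫⁻ y, V y ∂κ x + 1 ≤ V x + C.indicator (fun _ => K) x)
    (hreach : ∀ x ∈ C, ∃ n, avoidProb κ A n x < 1) {x : S} (hx : x ∈ T) :
    ∑' n, avoidProb κ A n x < ∞ := by
  obtain ⟨w, hw_top, hw_drift⟩ := exists_setLIntegral_add_indicator_le hA hC hreach hK
  have hW_drift : ∀ y ∈ T, ∫⁻ z in Aᶜ, (V z + w z) ∂κ y + 1 ≤ V y + w y := by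
    intro y hy
    calc ∫⁻ z in Aᶜ, (V z + w z) ∂κ y + 1
      _ ≤ ∫⁻ z, V z ∂κ y + 1 + ∫⁻ z in Aᶜ, w z ∂κ y := by
        rw [lintegral_add_left hV, add_right_comm]
        gcongr
        exact Measure.restrict_le_self
      _ ≤ V y + C.indicator (fun _ => K) y + ∫⁻ z in Aᶜ, w z ∂κ y := by
        gcongr 1
        exact hdrift y hy
      _ ≤ V y + w y := by
        rw [add_assoc, add_comm (C.indicator _ y)]
        gcongr
        exact hw_drift y
  rw [ENNReal.tsum_eq_iSup_nat]
  exact (iSup_le fun n => sum_avoidProb_le hA hT hW_drift n hx).trans_lt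
    (ENNReal.add_lt_top.2 ⟨(hV_top x).lt_top, (hw_top x).lt_top⟩)

end Kernel

section Entrance

variable {Ω S : Type*} {X : ℕ → Ω → S} {A : Set S}

/-- The event that `X` avoids `A` at the times `1, …, n`. -/
def avoidEvent (X : ℕ → Ω → S) (A : Set S) (n : ℕ) : Set Ω :=
  {ω | ∀ k, 1 ≤ k → k ≤ n → X k ω ∉ A}

/-- The first time after time `0` at which `X` is in `A` (`∞` if there is none). -/
noncomputable def entranceTime (X : ℕ → Ω → S) (A : Set S) (ω : Ω) : ℝ≥0∞ :=
  ⨅ (n : ℕ) (_ : 1 ≤ n ∧ X n ω ∈ A), (n : ℝ≥0∞)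

lemma avoidEvent_zero : avoidEvent X A 0 = Set.univ :=
  Set.eq_univ_of_forall fun _ _ h1 h0 => absurd (h1.trans h0) (by simp)

lemma avoidEvent_succ (n : ℕ) :
    avoidEvent X A (n + 1) = X (n + 1) ⁻¹' Aᶜ ∩ avoidEvent X A n := by
  ext ω
  refine ⟨fun h => ⟨h _ (by simp) le_rfl, fun k hk hkn => h k hk (by omega)⟩, ?_⟩
  rintro ⟨hlast, h⟩ k hk hkn
  rcases hkn.eq_or_lt with rfl | hlt
  · exact hlast
  · exact h k hk (by omega)

lemma entranceTime_le_tsum (ω : Ω) :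
    entranceTime X A ω ≤ ∑' n, (avoidEvent X A n).indicator 1 ω := by
  classical
  by_cases h : ∃ n, 1 ≤ n ∧ X n ω ∈ A
  · have havoid : ∀ n ∈ Finset.range (Nat.find h), ω ∈ avoidEvent X A n := fun n hn k hk hkn hkA =>
      Nat.find_min h (hkn.trans_lt (Finset.mem_range.1 hn)) ⟨hk, hkA⟩
    calc entranceTime X A ω
      _ ≤ (Nat.find h : ℝ≥0∞) := iInf₂_le (Nat.find h) (Nat.find_spec h)
      _ = ∑ n ∈ Finset.range (Nat.find h), (avoidEvent X A n).indicator 1 ω := by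
        rw [Finset.sum_congr rfl fun n hn => Set.indicator_of_mem (havoid n hn) 1]
        simp
      _ ≤ _ := ENNReal.sum_le_tsum _
  · push Not at h
    have havoid (n : ℕ) : ω ∈ avoidEvent X A n := fun k hk _ => h k hk
    simp [havoid]

end Entrance

section MarkovChain

variable {Ω S : Type*} [mΩ : MeasurableSpace Ω] [MeasurableSpace S]

/-- `X` is a Markov chain with transition kernel `κ` relative to the filtration `ℱ`. The Markov
property is stated for integrals over events of the past, which avoids conditional expectations of
functions that need not be integrable. -/
structure IsMarkovChain (κ : Kernel S S) (ℱ : Filtration ℕ mΩ) (X : ℕ → Ω → S) (μ : Measure Ω) :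
    Prop where
  measurable : ∀ n, Measurable[ℱ n] (X n)
  setLIntegral_succ : ∀ n {E : Set Ω}, MeasurableSet[ℱ n] E → ∀ {g : S → ℝ≥0∞}, Measurable g →
    ∫⁻ ω in E, g (X (n + 1) ω) ∂μ = ∫⁻ ω in E, ∫⁻ y, g y ∂κ (X n ω) ∂μ

variable {κ : Kernel S S} {ℱ : Filtration ℕ mΩ} {X : ℕ → Ω → S} {μ : Measure Ω} {A : Set S}

namespace IsMarkovChain

variable (hX : IsMarkovChain κ ℱ X μ)

include hX

lemma measurableSet_avoidEvent (hA : MeasurableSet A) (n : ℕ) :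
    MeasurableSet[ℱ n] (avoidEvent X A n) := by
  induction n with
  | zero => simp [avoidEvent_zero]
  | succ n ih =>
    rw [avoidEvent_succ]
    exact (hX.measurable _ hA.compl).inter (ℱ.mono n.le_succ _ ih)

lemma measure_eq_succ_pos [MeasurableSingletonClass S] {n : ℕ} {y z : S}
    (hy : 0 < μ {ω | X n ω = y}) (hz : κ y {z} ≠ 0) : 0 < μ {ω | X (n + 1) ω = z} := by
  have hmeas : MeasurableSet[ℱ n] {ω | X n ω = y} := hX.measurable n (measurableSet_singleton y)
  have hmeas' : MeasurableSet {ω | X (n + 1) ω = z} :=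
    ℱ.le _ _ (hX.measurable _ (measurableSet_singleton z))
  calc 0
    _ < κ y {z} * μ {ω | X n ω = y} := ENNReal.mul_pos hz hy.ne'
    _ = ∫⁻ ω in {ω | X n ω = y}, κ (X n ω) {z} ∂μ := by
      rw [← setLIntegral_const]
      exact setLIntegral_congr_fun (ℱ.le n _ hmeas) fun ω hω => by rw [show X n ω = y from hω]
    _ = ∫⁻ ω in {ω | X n ω = y}, ({z} : Set S).indicator 1 (X (n + 1) ω) ∂μ := by
      rw [hX.setLIntegral_succ n hmeas (measurable_one.indicator (measurableSet_singleton z))]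
      simp only [lintegral_indicator_one (measurableSet_singleton z)]
    _ = μ ({ω | X (n + 1) ω = z} ∩ {ω | X n ω = y}) := by
      rw [← Measure.restrict_apply hmeas', ← lintegral_indicator_one hmeas']
      rfl
    _ ≤ μ {ω | X (n + 1) ω = z} := measure_mono Set.inter_subset_left

variable [IsSFiniteKernel κ]

lemma setLIntegral_avoidProb (hA : MeasurableSet A) (n k : ℕ) :
    ∫⁻ ω in avoidEvent X A k, avoidProb κ A n (X k ω) ∂μ = μ (avoidEvent X A (k + n)) := by
  induction n generalizing k with
  | zero => simp [avoidProb]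
  | succ n ih =>
    have hmeas : MeasurableSet (X (k + 1) ⁻¹' Aᶜ) := ℱ.le _ _ (hX.measurable _ hA.compl)
    calc ∫⁻ ω in avoidEvent X A k, ∫⁻ y in Aᶜ, avoidProb κ A n y ∂κ (X k ω) ∂μ
      _ = ∫⁻ ω in avoidEvent X A k, Aᶜ.indicator (avoidProb κ A n) (X (k + 1) ω) ∂μ := by
        rw [hX.setLIntegral_succ k (hX.measurableSet_avoidEvent hA k)
          ((measurable_avoidProb hA n).indicator hA.compl)]
        simp only [lintegral_indicator hA.compl]
      _ = ∫⁻ ω in avoidEvent X A (k + 1), avoidProb κ A n (X (k + 1) ω) ∂μ := by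
        rw [avoidEvent_succ, ← setLIntegral_indicator hmeas]
        rfl
      _ = μ (avoidEvent X A (k + (n + 1))) := by rw [ih, add_right_comm, add_assoc]

lemma avoidProb_eq [IsProbabilityMeasure μ] (hA : MeasurableSet A) {x : S}
    (h0 : ∀ ω, X 0 ω = x) (n : ℕ) : avoidProb κ A n x = μ (avoidEvent X A n) := by
  have := hX.setLIntegral_avoidProb hA n 0
  simpa [avoidEvent_zero, h0] using this

lemma lintegral_entranceTime_le [IsProbabilityMeasure μ] (hA : MeasurableSet A) {x : S}
    (h0 : ∀ ω, X 0 ω = x) : ∫⁻ ω, entranceTime X A ω ∂μ ≤ ∑' n, avoidProb κ A n x := by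
  have hmeas (n : ℕ) : MeasurableSet (avoidEvent X A n) :=
    ℱ.le n _ (hX.measurableSet_avoidEvent hA n)
  calc ∫⁻ ω, entranceTime X A ω ∂μ
    _ ≤ ∫⁻ ω, ∑' n, (avoidEvent X A n).indicator 1 ω ∂μ := lintegral_mono entranceTime_le_tsum
    _ = ∑' n, avoidProb κ A n x := by
      rw [lintegral_tsum fun n => (measurable_one.indicator (hmeas n)).aemeasurable]
      simp only [lintegral_indicator_one (hmeas _), hX.avoidProb_eq hA h0]

end IsMarkovChain

end MarkovChain

section PositiveRecurrence

variable {Ω S : Type*} [mΩ : MeasurableSpace Ω] {μ : Measure Ω} [MeasurableSpace S] [Countable S]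
  [MeasurableSingletonClass S] {κ : Kernel S S} {ℱ : Filtration ℕ mΩ}

lemma IsMarkovChain.ae_mem_of_measure_eq_pos {X : ℕ → Ω → S} (hX : IsMarkovChain κ ℱ X μ) {x : S}
    (hx : ∃ n, 0 < μ {ω | X n ω = x}) : ∀ᵐ y ∂κ x, ∃ n, 0 < μ {ω | X n ω = y} := by
  obtain ⟨n, hn⟩ := hx
  exact ae_iff_of_countable.2 fun y hy => ⟨n + 1, hX.measure_eq_succ_pos hn hy⟩

variable [IsMarkovKernel κ] [IsProbabilityMeasure μ] {X : S → ℕ → Ω → S}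

lemma exists_avoidProb_singleton_lt_one (hX : ∀ x, IsMarkovChain κ ℱ (X x) μ)
    (h0 : ∀ x ω, X x 0 ω = x) {x y : S} (h : ∀ᵐ z ∂κ y, ∃ n, 0 < μ {ω | X z n ω = x}) :
    ∃ n, avoidProb κ {x} n y < 1 := by
  obtain ⟨z, hz⟩ : ∃ z, κ y {z} ≠ 0 := by
    by_contra! hnull
    exact IsProbabilityMeasure.ne_zero (κ y) (Measure.ext_of_singleton (by simpa using hnull))
  obtain ⟨n, hn⟩ := ae_iff_of_countable.1 h z hz
  refine ⟨n + 1, avoidProb_succ_lt_one (measurableSet_singleton x) hz ?_⟩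
  rcases n.eq_zero_or_pos with rfl | hn_pos
  · left
    by_contra hzx
    simp [h0, show z ≠ x from hzx] at hn
  · right
    rw [(hX z).avoidProb_eq (measurableSet_singleton x) (h0 z), ← measure_univ (μ := μ)]
    have hmeas : MeasurableSet {ω | X z n ω = x} :=
      ℱ.le n _ ((hX z).measurable n (measurableSet_singleton x))
    calc μ (avoidEvent (X z) {x} n)
      _ ≤ μ {ω | X z n ω = x}ᶜ := measure_mono fun ω hω => hω n hn_pos le_rfl
      _ < μ Set.univ := by
        rw [prob_compl_eq_one_sub hmeas, measure_univ]
        exact ENNReal.sub_lt_self ENNReal.one_ne_top one_ne_zero hn.ne'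

/-- Foster's criterion. -/
theorem lintegral_entranceTime_singleton_lt_top (hX : ∀ x, IsMarkovChain κ ℱ (X x) μ)
    (h0 : ∀ x ω, X x 0 ω = x) {T : Set S} (hT : ∀ x ∈ T, ∀ᵐ y ∂κ x, y ∈ T)
    (hirr : ∀ x ∈ T, ∀ y ∈ T, ∃ n, 0 < μ {ω | X x n ω = y})
    {V : S → ℝ≥0∞} (hV_top : ∀ x, V x ≠ ∞) {C : Set S} (hC : C.Finite) {K : ℝ≥0∞} (hK : K ≠ ∞)
    (hdrift : ∀ x ∈ T, ∫⁻ y, V y ∂κ x + 1 ≤ V x + C.indicator (fun _ => K) x) {x : S}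
    (hx : x ∈ T) : ∫⁻ ω, entranceTime (X x) {x} ω ∂μ < ∞ := by
  refine ((hX x).lintegral_entranceTime_le (measurableSet_singleton x) (h0 x)).trans_lt ?_
  refine tsum_avoidProb_lt_top (measurableSet_singleton x) hT (measurable_of_countable V) hV_top
    (hC.inter_of_left T) hK (fun y hy => (hdrift y hy).trans_eq ?_) (fun y hy => ?_) hx
  · by_cases hyC : y ∈ C <;> simp [hy, hyC]
  · exact exists_avoidProb_singleton_lt_one hX h0
      ((hT y hy.2).mono fun z hz => hirr z hz x hx)

end PositiveRecurrence

section Recursion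

variable {Ω S L : Type*} [mΩ : MeasurableSpace Ω] {μ : Measure Ω} [MeasurableSpace S]
  [MeasurableSpace L]

/-- The filtration whose `n`-th term is generated by `Y 0, …, Y (n - 1)`. -/
def strictPast (Y : ℕ → Ω → L) (hY : ∀ n, Measurable (Y n)) : Filtration ℕ mΩ where
  seq n := ⨆ k ∈ Set.Iio n, MeasurableSpace.comap (Y k) inferInstance
  mono' _ _ hmn := biSup_mono fun _ hk => lt_of_lt_of_le hk hmn
  le' _ := iSup₂_le fun k _ => (hY k).comap_le

lemma IsIID.indep_strictPast {Y : ℕ → Ω → L} {ν : Measure L} (hY : IsIID Y ν μ)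
    (hY_meas : ∀ n, Measurable (Y n)) (n : ℕ) :
    Indep (strictPast Y hY_meas n) (MeasurableSpace.comap (Y n) inferInstance) μ := by
  have h := indep_iSup_of_disjoint (fun k => (hY_meas k).comap_le) hY.iIndepFun.iIndep
    (S := Set.Iio n) (T := {n}) (by simp)
  rwa [iSup_singleton] at h

/-- The transition kernel of the recursion `X (n + 1) = f (X n) (Y n)` driven by independent
random variables `Y n` with law `ν`. -/
noncomputable def recursionKernel (f : S → L → S) (ν : Measure L) : Kernel S S :=
  (Kernel.id ×ₖ Kernel.const S ν).map fun p => f p.1 p.2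

variable {f : S → L → S} (hf : Measurable fun p : S × L => f p.1 p.2) {ν : Measure L}

include hf

lemma isMarkovKernel_recursionKernel [IsProbabilityMeasure ν] :
    IsMarkovKernel (recursionKernel f ν) :=
  Kernel.IsMarkovKernel.map _ hf

lemma lintegral_recursionKernel [SFinite ν] {g : S → ℝ≥0∞} (hg : Measurable g) (x : S) :
    ∫⁻ y, g y ∂recursionKernel f ν x = ∫⁻ l, g (f x l) ∂ν := by
  rw [recursionKernel, Kernel.lintegral_map _ hf _ hg, Kernel.lintegral_id_prod (by fun_prop)]
  simp

theorem IsIID.isMarkovChain_recursion [IsProbabilityMeasure ν] {Y : ℕ → Ω → L}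
    (hY : IsIID Y ν μ) (hY_meas : ∀ n, Measurable (Y n)) {X : ℕ → Ω → S} {x : S}
    (h0 : ∀ ω, X 0 ω = x) (hX : ∀ n ω, X (n + 1) ω = f (X n ω) (Y n ω)) :
    IsMarkovChain (recursionKernel f ν) (strictPast Y hY_meas) X μ := by
  have := (hY.hasLaw 0).isProbabilityMeasure
  set ℱ := strictPast Y hY_meas
  have hY_past (n : ℕ) : Measurable[ℱ (n + 1)] (Y n) :=
    (comap_measurable (Y n)).mono (le_biSup (fun k => MeasurableSpace.comap (Y k) inferInstance)
      (Set.mem_Iio.2 n.lt_succ_self)) le_rfl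
  have hX_past (n : ℕ) : Measurable[ℱ n] (X n) := by
    induction n with
    | zero => rw [funext h0]; exact measurable_const
    | succ n ih =>
      rw [funext (hX n)]
      exact hf.comp ((ih.mono (ℱ.mono n.le_succ) le_rfl).prodMk (hY_past n))
  refine ⟨hX_past, fun n E hE g hg => ?_⟩
  have hE' : MeasurableSet E := ℱ.le n E hE
  have hX' : Measurable[ℱ n] fun ω => (E.indicator (1 : Ω → ℝ≥0∞) ω, X n ω) :=
    (measurable_const.indicator hE).prodMk (hX_past n)
  have hind : IndepFun (fun ω => (E.indicator (1 : Ω → ℝ≥0∞) ω, X n ω)) (Y n) μ :=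
    indep_of_indep_of_le_left (hY.indep_strictPast hY_meas n) hX'.comap_le
  have hgf : Measurable fun p : (ℝ≥0∞ × S) × L => p.1.1 * g (f p.1.2 p.2) :=
    (measurable_fst.comp measurable_fst).mul
      (hg.comp (hf.comp ((measurable_snd.comp measurable_fst).prodMk measurable_snd)))
  have hfubini := lintegral_comp_prodMk_of_indepFun (hX'.mono (ℱ.le n) le_rfl) (hY_meas n) hind hgf
  simp only [(hY.hasLaw n).map_eq] at hfubini
  have hmul (h : Ω → ℝ≥0∞) : ∫⁻ ω in E, h ω ∂μ = ∫⁻ ω, E.indicator 1 ω * h ω ∂μ := by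
    rw [← lintegral_indicator hE']
    refine lintegral_congr fun ω => ?_
    by_cases hω : ω ∈ E <;> simp [hω]
  simp only [hmul, hX, lintegral_recursionKernel hf hg, hfubini]
  refine lintegral_congr fun ω => lintegral_const_mul _ ?_
  exact hg.comp (hf.comp measurable_prodMk_left)

end Recursion

section Loading

variable {F : Type*}

/-- The number of unprocessed tokens of a request. -/
def Request.size (q : Request F) : ℕ := q.prefill + q.decode

/-- The request `q` after the load `d` has been taken from it. -/
def Request.afterLoad (q : Request F) (d : Load) : Request F where
  prefill := q.prefill - d.prefill
  decode := q.decode - d.decode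
  feature := q.feature

/-- The batch selected in state `x` is feasible, apart from the token budget. -/
def IsFeasible (π : Policy F) (x : State F) : Prop :=
  ∀ i : Fin x.queue.length,
    (0 < (x.queue.get i).prefill → (π x i).decode = 0) ∧
    (π x i).prefill ≤ (x.queue.get i).prefill ∧ (π x i).decode ≤ 1

lemma Request.size_afterLoad_add {q : Request F} {d : Load} (hp : d.prefill ≤ q.prefill)
    (hd : d.decode ≤ q.decode) : (q.afterLoad d).size + (d.decode + d.prefill) = q.size := by
  simp only [Request.size, Request.afterLoad]
  omega

lemma sum_map_eq_sum_get {E M : Type*} [AddCommMonoid M] (l : List E) (φ : E → M) :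
    (l.map φ).sum = ∑ i, φ (l.get i) := by
  simp [← Fin.sum_univ_getElem]

lemma loadedQueue_eq_filter (π : Policy F) (x : State F) :
    loadedQueue π x =
      (List.ofFn fun i => (x.queue.get i).afterLoad (π x i)).filter fun q => q.decode ≠ 0 := rfl

lemma sum_map_loadedQueue_le (π : Policy F) (x : State F) (φ : Request F → ℕ) :
    ((loadedQueue π x).map φ).sum ≤ ∑ i, φ ((x.queue.get i).afterLoad (π x i)) := by
  rw [loadedQueue_eq_filter]
  refine ((List.filter_sublist.map φ).sum_le_sum (by simp)).trans_eq ?_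
  simp [List.sum_ofFn, Function.comp_def]

lemma State.Valid.step {t : ℕ → ℕ} {π : Policy F} {x : State F} (hx : x.Valid)
    {new : List (Request F)} (hnew : ∀ q ∈ new, 1 ≤ q.decode) : (step t π x new).Valid := by
  intro q hq
  unfold LLMEngine.step at hq
  split_ifs at hq with hR
  · rcases List.mem_append.1 hq with hq | hq
    · rw [loadedQueue_eq_filter, List.mem_filter] at hq
      simpa [Nat.one_le_iff_ne_zero] using hq.2
    · exact hnew q hq
  · rcases List.mem_append.1 hq with hq | hq
    · exact hx q hq
    · exact hnew q hq

lemma IsFeasible.eq_of_tokenLoad_eq_available {π : Policy F} {x : State F}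
    (hπ : IsFeasible π x) (h : tokenLoad π x = x.available) (i : Fin x.queue.length) :
    (π x i).prefill = (x.queue.get i).prefill ∧
      (π x i).decode = if (x.queue.get i).prefill = 0 then 1 else 0 := by
  rw [State.available, sum_map_eq_sum_get, tokenLoad] at h
  have hle (j : Fin x.queue.length) : (π x j).decode + (π x j).prefill ≤
      (x.queue.get j).prefill + if (x.queue.get j).prefill = 0 then 1 else 0 := by
    have := hπ j
    split_ifs <;> omega
  have heq := (Finset.sum_eq_sum_iff_of_le fun j _ => hle j).1 h i (Finset.mem_univ i)
  have := hπ i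
  split_ifs at heq ⊢ <;> omega

end Loading

section Lyapunov

variable {F : Type*}

/-- An upper bound for the number of batches that still have to contain tokens of the request `q`
if every available token of `q` is always loaded. -/
def Request.batchesLeft (q : Request F) : ℕ := q.decode + if q.prefill = 0 then 0 else 1

/-- The contribution of a request to the Lyapunov function. The linear term decreases when the
batch is full, the quadratic term when all the available tokens are loaded. -/
def Request.weight (h : ℕ) (q : Request F) : ℕ := h * q.size + q.batchesLeft ^ 2

/-- The Lyapunov function of the chain. Every slot of remaining processing time counts as `c`, so
that the loss of a long batch is paid for at the time of loading. -/
def State.lyapunov (h c : ℕ) (x : State F) : ℕ :=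
  (x.queue.map (Request.weight h)).sum + c * x.remaining

/-- The states of at most `M` tokens in which a batch is loaded. -/
def smallStates (F : Type*) (M : ℕ) : Set (State F) :=
  {x | x.Valid ∧ x.remaining = 0 ∧ x.size ≤ M}

lemma Request.batchesLeft_afterLoad_le (q : Request F) (d : Load) :
    (q.afterLoad d).batchesLeft ≤ q.batchesLeft := by
  grind [Request.batchesLeft, Request.afterLoad]

lemma Request.batchesLeft_afterLoad_add_one {q : Request F} (hq : 1 ≤ q.decode) {d : Load}
    (hp : d.prefill = q.prefill) (hd : d.decode = if q.prefill = 0 then 1 else 0) :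
    (q.afterLoad d).batchesLeft + 1 = q.batchesLeft := by
  simp only [Request.batchesLeft, Request.afterLoad, hp, hd, Nat.sub_self, if_true]
  split_ifs <;> omega

lemma Request.weight_afterLoad_add_le (h : ℕ) {q : Request F} {d : Load}
    (hp : d.prefill ≤ q.prefill) (hd : d.decode ≤ q.decode) :
    (q.afterLoad d).weight h + h * (d.decode + d.prefill) ≤ q.weight h := by
  calc h * (q.afterLoad d).size + (q.afterLoad d).batchesLeft ^ 2 + h * (d.decode + d.prefill)
    _ = h * q.size + (q.afterLoad d).batchesLeft ^ 2 := by
      rw [← Request.size_afterLoad_add hp hd]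
      ring
    _ ≤ h * q.size + q.batchesLeft ^ 2 := by
      gcongr
      exact q.batchesLeft_afterLoad_le d

lemma Request.weight_afterLoad_add_decode_le (h : ℕ) {q : Request F} (hq : 1 ≤ q.decode)
    {d : Load} (hp : d.prefill = q.prefill) (hd : d.decode = if q.prefill = 0 then 1 else 0) :
    (q.afterLoad d).weight h + q.decode ≤ q.weight h := by
  have hdecode : d.decode ≤ q.decode := by split_ifs at hd <;> omega
  have hsize : h * (q.afterLoad d).size ≤ h * q.size :=
    Nat.mul_le_mul_left h (Nat.le.intro (Request.size_afterLoad_add hp.le hdecode))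
  have hbatches := Request.batchesLeft_afterLoad_add_one hq hp hd
  have hle : q.decode ≤ q.batchesLeft := Nat.le_add_right _ _
  rw [Request.weight, Request.weight, ← hbatches]
  nlinarith

lemma lyapunov_step (t : ℕ → ℕ) (π : Policy F) (x : State F) (new : List (Request F))
    (h c : ℕ) : (step t π x new).lyapunov h c =
      (step t π x []).lyapunov h c + (new.map (Request.weight h)).sum := by
  unfold State.lyapunov step
  split_ifs <;> simp only [List.map_append, List.sum_append, List.map_nil, List.sum_nil] <;> ring

lemma lyapunov_step_of_remaining_ne_zero (t : ℕ → ℕ) (π : Policy F) {x : State F}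
    (hR : x.remaining ≠ 0) (h c : ℕ) :
    (step t π x []).lyapunov h c + c = x.lyapunov h c := by
  obtain ⟨r, hr⟩ := Nat.exists_eq_succ_of_ne_zero hR
  simp [State.lyapunov, step, hr, mul_add, add_assoc]

lemma lyapunov_step_add_sum_le {t : ℕ → ℕ} {π : Policy F} {x : State F} (hR : x.remaining = 0)
    (ht : 1 ≤ t (tokenLoad π x)) {h : ℕ} (c : ℕ) {g : Fin x.queue.length → ℕ}
    (hg : ∀ i, ((x.queue.get i).afterLoad (π x i)).weight h + g i ≤ (x.queue.get i).weight h) :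
    (step t π x []).lyapunov h c + c + ∑ i, g i ≤ x.lyapunov h c + c * t (tokenLoad π x) := by
  have hsum : ((loadedQueue π x).map (Request.weight h)).sum + ∑ i, g i ≤
      (x.queue.map (Request.weight h)).sum := by
    rw [sum_map_eq_sum_get x.queue]
    grw [sum_map_loadedQueue_le, ← Finset.sum_add_distrib]
    exact Finset.sum_le_sum fun i _ => hg i
  obtain ⟨s, hs⟩ := Nat.exists_eq_add_of_le' ht
  simp only [State.lyapunov, step, hR, if_true, hs, List.append_nil, mul_add, mul_zero, mul_one,
    Nat.add_sub_cancel]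
  omega

lemma State.size_le_available_add (x : State F) :
    x.size ≤ x.available + (x.queue.map Request.decode).sum := by
  rw [State.size, State.available, ← List.sum_map_add]
  exact List.sum_le_sum fun q _ => by omega

lemma lyapunov_drift {b : ℕ} {t : ℕ → ℕ} {T : ℕ} (ht : ∀ k ≤ b, 1 ≤ t k ∧ t k ≤ T) {h c : ℕ}
    (hc : c * t b ≤ h * b) {π : Policy F} {x : State F} (hx : x.Valid)
    (hπ : x.remaining = 0 → IsFeasible π x)
    (hwc : x.remaining = 0 → tokenLoad π x = min b x.available) :
    (step t π x []).lyapunov h c + c ≤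
      x.lyapunov h c + (smallStates F (c * T + b)).indicator (fun _ => c * T) x := by
  by_cases hR : x.remaining = 0
  swap
  · exact (lyapunov_step_of_remaining_ne_zero t π hR h c).le.trans (Nat.le_add_right _ _)
  have hfeas := hπ hR
  have hload := hwc hR
  obtain ⟨ht_pos, ht_le⟩ := ht _ (hload.trans_le (min_le_left _ _))
  have hT : c * t (tokenLoad π x) ≤ c * T := Nat.mul_le_mul_left c ht_le
  have hvalid (i : Fin x.queue.length) := hx _ (List.get_mem x.queue i)
  have hlinear : (step t π x []).lyapunov h c + c + h * tokenLoad π x ≤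
      x.lyapunov h c + c * t (tokenLoad π x) := by
    rw [tokenLoad, Finset.mul_sum]
    exact lyapunov_step_add_sum_le hR ht_pos c fun i =>
      Request.weight_afterLoad_add_le h (hfeas i).2.1 ((hfeas i).2.2.trans (hvalid i))
  by_cases hsmall : x ∈ smallStates F (c * T + b)
  · rw [Set.indicator_of_mem hsmall]
    omega
  rw [Set.indicator_of_notMem hsmall, add_zero]
  rcases le_or_gt b x.available with hb | hb
  · rw [hload, min_eq_left hb] at hlinear
    omega
  · rw [min_eq_right hb.le] at hload
    have hquadratic := lyapunov_step_add_sum_le hR ht_pos c fun i =>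
      Request.weight_afterLoad_add_decode_le h (hvalid i)
        (hfeas.eq_of_tokenLoad_eq_available hload i).1
        (hfeas.eq_of_tokenLoad_eq_available hload i).2
    rw [← sum_map_eq_sum_get x.queue Request.decode] at hquadratic
    have hlarge : c * T + b < x.size := not_le.1 fun hle => hsmall ⟨hx, hR, hle⟩
    have := x.size_le_available_add
    omega

lemma finite_smallStates [Finite F] (M : ℕ) : (smallStates F M).Finite := by
  let toRequest : Fin (M + 1) × Fin (M + 1) × F → Request F := fun p => ⟨p.1, p.2.1, p.2.2⟩
  let toState : List (Fin (M + 1) × Fin (M + 1) × F) → State F := fun l => ⟨0, l.map toRequest⟩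
  refine ((List.finite_length_le (Fin (M + 1) × Fin (M + 1) × F) M).image toState).subset ?_
  rintro ⟨r, Q⟩ ⟨hvalid, hr : r = 0, hsize⟩
  have hmem (q) (hq : q ∈ Q) : q.prefill + q.decode ≤ M :=
    (List.single_le_sum (by simp) _ (List.mem_map_of_mem hq)).trans hsize
  have hlen : Q.length ≤ M := by
    calc Q.length
      _ = (Q.map fun _ => 1).sum := by simp
      _ ≤ (Q.map fun q => q.prefill + q.decode).sum :=
        List.sum_le_sum fun q hq => (hvalid q hq).trans (Nat.le_add_left _ _)
      _ ≤ M := hsize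
  refine ⟨Q.attach.map fun q => (⟨q.1.prefill, ?_⟩, ⟨q.1.decode, ?_⟩, q.1.feature), ?_, ?_⟩
  · exact Nat.lt_succ_of_le ((Nat.le_add_right _ _).trans (hmem q.1 q.2))
  · exact Nat.lt_succ_of_le ((Nat.le_add_left _ _).trans (hmem q.1 q.2))
  · simpa using hlen
  · simp only [toState, toRequest, hr, List.map_map]
    exact congrArg _ (List.attach_map_subtype_val Q)

end Lyapunov

instance {F : Type*} : MeasurableSpace (Request F) := ⊤

instance {F : Type*} : DiscreteMeasurableSpace (Request F) := ⟨fun _ => trivial⟩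

instance {F : Type*} : MeasurableSpace (State F) := ⊤

instance {F : Type*} : DiscreteMeasurableSpace (State F) := ⟨fun _ => trivial⟩

instance {F : Type*} [Countable F] : Countable (Request F) :=
  Function.Injective.countable (f := fun q : Request F => (q.prefill, q.decode, q.feature))
    fun _ _ h => by simpa [Request.ext_iff] using h

instance {F : Type*} [Countable F] : Countable (State F) :=
  Function.Injective.countable (f := fun x : State F => (x.remaining, x.queue))
    fun _ _ h => by simpa [State.ext_iff] using h

section Model

variable {Ω F : Type*} {t : ℕ → ℕ} {π : Policy F} {a vp vd : ℕ → Ω → ℕ} {z : ℕ → Ω → F}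

/-- The `i`-th request in the order of arrival, as it arrives. -/
def request (vp vd : ℕ → Ω → ℕ) (z : ℕ → Ω → F) (i : ℕ) (ω : Ω) : Request F :=
  ⟨vp i ω, vd i ω, z i ω⟩

lemma arrivals_eq_blocks : arrivals a vp vd z = blocks a (request vp vd z) := rfl

lemma valid_chain (hvd : ∀ i ω, 1 ≤ vd i ω) {x : State F} (hx : x.Valid) (n : ℕ) (ω : Ω) :
    (chain t π a vp vd z x n ω).Valid := by
  induction n with
  | zero => exact hx
  | succ n ih =>
    refine ih.step fun q hq => ?_
    obtain ⟨j, -, rfl⟩ := List.mem_map.1 hq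
    exact hvd _ ω

variable [MeasurableSpace Ω] {μ : Measure Ω}

lemma valid_of_mem_stateSpace (hvd : ∀ i ω, 1 ≤ vd i ω) {x₀ x : State F} (hx₀ : x₀.Valid)
    (hx : x ∈ stateSpace μ (chain t π a vp vd z) x₀) : x.Valid := by
  obtain ⟨n, hn⟩ := hx
  obtain ⟨ω, rfl⟩ := nonempty_of_measure_ne_zero hn.ne'
  exact valid_chain hvd hx₀ n ω

variable [Countable F] [MeasurableSpace F] [MeasurableSingletonClass F]

lemma measurable_request_mk :
    Measurable fun p : ℕ × ℕ × F => (⟨p.1, p.2.1, p.2.2⟩ : Request F) :=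
  measurable_of_countable _

lemma measurable_request (hvp : ∀ i, Measurable (vp i)) (hvd : ∀ i, Measurable (vd i))
    (hz : ∀ i, Measurable (z i)) (i : ℕ) : Measurable (request vp vd z i) :=
  measurable_request_mk.comp ((hvp i).prodMk ((hvd i).prodMk (hz i)))

lemma isIID_request (hv_indep : iIndepFun (fun i ω => (vp i ω, vd i ω, z i ω)) μ)
    (hv_ident : ∀ i, IdentDistrib (fun ω => (vp i ω, vd i ω, z i ω))
      (fun ω => (vp 0 ω, vd 0 ω, z 0 ω)) μ μ) :
    IsIID (request vp vd z) (μ.map (request vp vd z 0)) μ :=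
  isIID_of_identDistrib (hv_indep.comp _ fun _ => measurable_request_mk)
    fun i => (hv_ident i).comp measurable_request_mk

lemma indepFun_request
    (hav_indep : IndepFun (fun ω n => a n ω) (fun ω i => (vp i ω, vd i ω, z i ω)) μ) :
    IndepFun (fun ω n => a n ω) (fun ω i => request vp vd z i ω) μ :=
  hav_indep.comp (φ := id)
    (ψ := fun (s : ℕ → ℕ × ℕ × F) i => (⟨(s i).1, (s i).2.1, (s i).2.2⟩ : Request F))
    measurable_id (measurable_pi_lambda _ fun i =>
      measurable_request_mk.comp (measurable_pi_apply i))

end Model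

section Recurrence

variable {Ω F : Type*} [MeasurableSpace Ω] {μ : Measure Ω} {t : ℕ → ℕ} {π : Policy F}
  {a vp vd : ℕ → Ω → ℕ} {z : ℕ → Ω → F}

lemma exists_nat_mul_add_le_of_lt {r s : ℝ} (hs : 0 ≤ s) (hrs : r < s) (q : ℝ) :
    ∃ h c : ℕ, h * r + q ≤ c ∧ c ≤ h * s := by
  obtain ⟨h, hh⟩ := exists_nat_ge ((q + 1) / (s - r))
  rw [div_le_iff₀ (sub_pos.2 hrs)] at hh
  refine ⟨h, ⌊h * s⌋₊, ?_, Nat.floor_le (by positivity)⟩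
  linarith [Nat.sub_one_lt_floor (h * s)]

lemma lintegral_weight_request_le (hvp_int : Integrable (fun ω => (vp 0 ω : ℝ)) μ)
    (hvd_int : Integrable (fun ω => (vd 0 ω : ℝ)) μ)
    (hvd_succ_sq : Integrable (fun ω => ((vd 0 ω : ℝ) + 1) ^ 2) μ) (h : ℕ) :
    ∫⁻ ω, (request vp vd z 0 ω).weight h ∂μ ≤
      ENNReal.ofReal (h * (∫ ω, (vp 0 ω : ℝ) ∂μ + ∫ ω, (vd 0 ω : ℝ) ∂μ) +
        ∫ ω, ((vd 0 ω : ℝ) + 1) ^ 2 ∂μ) := by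
  have hlinear : Integrable (fun ω => h * ((vp 0 ω : ℝ) + vd 0 ω)) μ :=
    (hvp_int.add hvd_int).const_mul _
  have hint : Integrable (fun ω => h * ((vp 0 ω : ℝ) + vd 0 ω) + ((vd 0 ω : ℝ) + 1) ^ 2) μ :=
    hlinear.add hvd_succ_sq
  rw [← integral_add hvp_int hvd_int, ← integral_const_mul, ← integral_add hlinear hvd_succ_sq,
    ofReal_integral_eq_lintegral_ofReal hint (ae_of_all _ fun ω => by positivity)]
  refine lintegral_mono fun ω => ?_
  have hle : (request vp vd z 0 ω).weight h ≤ h * (vp 0 ω + vd 0 ω) + (vd 0 ω + 1) ^ 2 := by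
    simp only [Request.weight, Request.size, Request.batchesLeft, request]
    gcongr
    grind
  rw [← ENNReal.ofReal_natCast]
  exact ENNReal.ofReal_le_ofReal (mod_cast hle)

theorem isIID_arrivals [IsProbabilityMeasure μ] [Countable F] [MeasurableSpace F]
    [MeasurableSingletonClass F]
    (ha_meas : ∀ n, Measurable (a n)) (hvp_meas : ∀ i, Measurable (vp i))
    (hvd_meas : ∀ i, Measurable (vd i)) (hz_meas : ∀ i, Measurable (z i))
    (ha_indep : iIndepFun a μ) (ha_ident : ∀ n, IdentDistrib (a n) (a 0) μ μ)
    (hv_indep : iIndepFun (fun i ω => (vp i ω, vd i ω, z i ω)) μ)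
    (hv_ident : ∀ i, IdentDistrib (fun ω => (vp i ω, vd i ω, z i ω))
      (fun ω => (vp 0 ω, vd 0 ω, z 0 ω)) μ μ)
    (hav_indep : IndepFun (fun ω n => a n ω) (fun ω i => (vp i ω, vd i ω, z i ω)) μ) :
    IsIID (arrivals a vp vd z) (μ.map (arrivals a vp vd z 0)) μ := by
  have hrequest_meas := measurable_request hvp_meas hvd_meas hz_meas
  have := Measure.isProbabilityMeasure_map (μ := μ) (ha_meas 0).aemeasurable
  have := Measure.isProbabilityMeasure_map (μ := μ) (hrequest_meas 0).aemeasurable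
  exact isIID_blocks (isIID_of_identDistrib ha_indep ha_ident) (isIID_request hv_indep hv_ident)
    ha_meas hrequest_meas (indepFun_request hav_indep)

theorem isPositiveRecurrentOn_of_lintegral_weight_add_one_le [IsProbabilityMeasure μ] [Finite F]
    {b : ℕ} (ht : ∀ k ≤ b, 1 ≤ t k) (hvd_pos : ∀ i ω, 1 ≤ vd i ω)
    {ν : Measure (List (Request F))} [IsProbabilityMeasure ν]
    (hY : IsIID (arrivals a vp vd z) ν μ) (hY_meas : ∀ n, Measurable (arrivals a vp vd z n))
    {h c : ℕ} (hν : ∫⁻ l, ((l.map (Request.weight h)).sum : ℕ) ∂ν + 1 ≤ c)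
    (hc : c * t b ≤ h * b) {x₀ : State F} (hx₀ : x₀.Valid)
    (hπ : IsSchedulingAlgorithm b π (stateSpace μ (chain t π a vp vd z) x₀))
    (hwc : IsWorkConserving b π (stateSpace μ (chain t π a vp vd z) x₀))
    (hirr : IsIrreducibleOn μ (chain t π a vp vd z) (stateSpace μ (chain t π a vp vd z) x₀)) :
    IsPositiveRecurrentOn μ (chain t π a vp vd z) (stateSpace μ (chain t π a vp vd z) x₀) := by
  have hf : Measurable fun p : State F × List (Request F) => step t π p.1 p.2 :=
    measurable_of_countable _
  have := isMarkovKernel_recursionKernel (ν := ν) hf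
  have hchain (x : State F) := hY.isMarkovChain_recursion hf hY_meas
    (X := chain t π a vp vd z x) (x := x) (fun _ => rfl) fun _ _ => rfl
  obtain ⟨T, hT⟩ : ∃ T, ∀ k ≤ b, 1 ≤ t k ∧ t k ≤ T :=
    ⟨(Finset.range (b + 1)).sup t, fun k hk =>
      ⟨ht k hk, Finset.le_sup (Finset.mem_range.2 (Nat.lt_succ_of_le hk))⟩⟩
  intro x hx
  refine lintegral_entranceTime_singleton_lt_top hchain (fun _ _ => rfl)
    (fun y hy => (hchain x₀).ae_mem_of_measure_eq_pos hy) hirr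
    (V := fun y => (y.lyapunov h c : ℝ≥0∞)) (fun _ => ENNReal.natCast_ne_top _)
    (finite_smallStates (c * T + b)) (K := (c * T : ℕ)) (ENNReal.natCast_ne_top _) ?_ hx
  intro y hy
  have hdrift := lyapunov_drift hT hc (valid_of_mem_stateSpace hvd_pos hx₀ hy)
    (fun hR => (hπ y hy hR).1) (hwc y hy)
  have hstep (l : List (Request F)) : ((step t π y l).lyapunov h c : ℝ≥0∞) =
      (step t π y []).lyapunov h c + ((l.map (Request.weight h)).sum : ℕ) :=
    mod_cast lyapunov_step t π y l h c
  rw [lintegral_recursionKernel hf (measurable_of_countable _), lintegral_congr hstep,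
    lintegral_add_left measurable_const, lintegral_const, measure_univ, mul_one, add_assoc]
  calc _ + (∫⁻ l, ((l.map (Request.weight h)).sum : ℕ) ∂ν + 1)
    _ ≤ (((step t π y []).lyapunov h c + c : ℕ) : ℝ≥0∞) := by
      rw [Nat.cast_add]
      gcongr
    _ ≤ _ := Nat.cast_le.2 hdrift
    _ = _ := by
      by_cases hsmall : y ∈ smallStates F (c * T + b) <;> simp [hsmall]

lemma lintegral_sum_weight_arrivals [IsFiniteMeasure μ] (ha_meas : Measurable (a 0))
    (ha_int : Integrable (fun ω => (a 0 ω : ℝ)) μ)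
    {ν : Measure (Request F)} (hrequest_meas : ∀ i, Measurable (request vp vd z i))
    (hrequest_law : ∀ i, HasLaw (request vp vd z i) ν μ)
    (hrequest_indep : IndepFun (a 0) (fun ω i => request vp vd z i ω) μ) (h : ℕ) :
    ∫⁻ ω, (((arrivals a vp vd z 0 ω).map (Request.weight h)).sum : ℕ) ∂μ =
      ENNReal.ofReal (∫ ω, (a 0 ω : ℝ) ∂μ) * ∫⁻ ω, (request vp vd z 0 ω).weight h ∂μ := by
  rw [ofReal_integral_eq_lintegral_ofReal ha_int (ae_of_all _ fun ω => by positivity)]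
  have hwald := lintegral_sum_map_history (g := fun q => (q.weight h : ℝ≥0∞)) ha_meas
    hrequest_meas hrequest_law hrequest_indep .of_discrete
  rw [← (hrequest_law 0).lintegral_comp Measurable.of_discrete.aemeasurable] at hwald
  simp only [ENNReal.ofReal_natCast]
  rw [← hwald]
  simp only [arrivals_eq_blocks, blocks, Finset.range_zero, Finset.sum_empty, zero_add,
    Nat.cast_list_sum, List.map_map]
  rfl

theorem isPositiveRecurrentOn_of_isWorkConserving [IsProbabilityMeasure μ] [Finite F]
    [MeasurableSpace F] [MeasurableSingletonClass F] {b : ℕ} (ht : ∀ k ≤ b, 1 ≤ t k)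
    (ha_meas : ∀ n, Measurable (a n)) (hvp_meas : ∀ i, Measurable (vp i))
    (hvd_meas : ∀ i, Measurable (vd i)) (hz_meas : ∀ i, Measurable (z i))
    (hvd_pos : ∀ i ω, 1 ≤ vd i ω)
    (ha_indep : iIndepFun a μ) (ha_ident : ∀ n, IdentDistrib (a n) (a 0) μ μ)
    (hv_indep : iIndepFun (fun i ω => (vp i ω, vd i ω, z i ω)) μ)
    (hv_ident : ∀ i, IdentDistrib (fun ω => (vp i ω, vd i ω, z i ω))
      (fun ω => (vp 0 ω, vd 0 ω, z 0 ω)) μ μ)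
    (hav_indep : IndepFun (fun ω n => a n ω) (fun ω i => (vp i ω, vd i ω, z i ω)) μ)
    (ha_int : Integrable (fun ω => (a 0 ω : ℝ)) μ)
    (hvp_int : Integrable (fun ω => (vp 0 ω : ℝ)) μ)
    (hvd_int : Integrable (fun ω => (vd 0 ω : ℝ)) μ)
    (hvd_sq : Integrable (fun ω => (vd 0 ω : ℝ) ^ 2) μ)
    (hload : (∫ ω, (a 0 ω : ℝ) ∂μ) * (∫ ω, (vp 0 ω : ℝ) ∂μ + ∫ ω, (vd 0 ω : ℝ) ∂μ) <
      (b : ℝ) / t b)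
    {x₀ : State F} (hx₀ : x₀.Valid)
    (hπ : IsSchedulingAlgorithm b π (stateSpace μ (chain t π a vp vd z) x₀))
    (hwc : IsWorkConserving b π (stateSpace μ (chain t π a vp vd z) x₀))
    (hirr : IsIrreducibleOn μ (chain t π a vp vd z) (stateSpace μ (chain t π a vp vd z) x₀)) :
    IsPositiveRecurrentOn μ (chain t π a vp vd z) (stateSpace μ (chain t π a vp vd z) x₀) := by
  have hrequest_meas := measurable_request hvp_meas hvd_meas hz_meas
  have harrivals_meas : ∀ n, Measurable (arrivals a vp vd z n) :=
    measurable_blocks ha_meas hrequest_meas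
  have hvd_succ_sq : Integrable (fun ω => ((vd 0 ω : ℝ) + 1) ^ 2) μ := by
    simp only [add_sq, one_pow, mul_one]
    exact (hvd_sq.add (hvd_int.const_mul 2)).add (integrable_const 1)
  have : IsProbabilityMeasure (μ.map (arrivals a vp vd z 0)) :=
    Measure.isProbabilityMeasure_map (harrivals_meas 0).aemeasurable
  obtain ⟨h, c, hle, hc⟩ := exists_nat_mul_add_le_of_lt (by positivity) hload
    ((∫ ω, (a 0 ω : ℝ) ∂μ) * (∫ ω, ((vd 0 ω : ℝ) + 1) ^ 2 ∂μ) + 1)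
  refine isPositiveRecurrentOn_of_lintegral_weight_add_one_le ht hvd_pos
    (isIID_arrivals ha_meas hvp_meas hvd_meas hz_meas ha_indep ha_ident hv_indep hv_ident
      hav_indep) harrivals_meas (h := h) (c := c) ?_ ?_ hx₀ hπ hwc hirr
  · have ha_nonneg : 0 ≤ ∫ ω, (a 0 ω : ℝ) ∂μ := integral_nonneg fun ω => by positivity
    rw [lintegral_map (measurable_of_countable _) (harrivals_meas 0),
      lintegral_sum_weight_arrivals (ha_meas 0) ha_int hrequest_meas
        (isIID_request hv_indep hv_ident).hasLaw
        ((indepFun_request hav_indep).comp (measurable_pi_apply 0) measurable_id)]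
    grw [lintegral_weight_request_le hvp_int hvd_int hvd_succ_sq h]
    rw [← ENNReal.ofReal_mul ha_nonneg, ← ENNReal.ofReal_one, ← ENNReal.ofReal_add,
      ← ENNReal.ofReal_natCast]
    · exact ENNReal.ofReal_le_ofReal (by linarith)
    · positivity
    · exact zero_le_one
  · have htb : (0 : ℝ) < t b := Nat.cast_pos.2 (ht b le_rfl)
    rw [← mul_div_assoc, le_div_iff₀ htb] at hc
    exact_mod_cast hc

end Recurrence

section Transience

variable {Ω F : Type*} {t : ℕ → ℕ} {π : Policy F} {b : ℕ} {a vp vd : ℕ → Ω → ℕ} {z : ℕ → Ω → F}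

lemma sum_map_filter_of_forall_eq_zero {E M : Type*} [AddCommMonoid M] {l : List E} {p : E → Prop}
    [DecidablePred p] {f : E → M} (h : ∀ q ∈ l, ¬ p q → f q = 0) :
    ((l.filter p).map f).sum = (l.map f).sum := by
  rw [← List.sum_map_filter_add_sum_map_filter_not p f l,
    List.sum_eq_zero (l := (l.filter fun q => ¬ p q).map f) (by grind), add_zero]

lemma IsFeasible.sum_size_loadedQueue_add {x : State F} (hπ : IsFeasible π x) (hx : x.Valid) :
    ((loadedQueue π x).map Request.size).sum + tokenLoad π x = x.size := by
  have hvalid (i : Fin x.queue.length) := hx _ (List.get_mem x.queue i)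
  have hempty (i : Fin x.queue.length) (hi : ((x.queue.get i).afterLoad (π x i)).decode = 0) :
      ((x.queue.get i).afterLoad (π x i)).size = 0 := by
    have := hπ i
    have := hvalid i
    simp only [Request.afterLoad, Request.size] at hi ⊢
    omega
  have hloaded : ((loadedQueue π x).map Request.size).sum =
      ∑ i, ((x.queue.get i).afterLoad (π x i)).size := by
    rw [loadedQueue_eq_filter, sum_map_filter_of_forall_eq_zero (by simpa using hempty),
      List.map_ofFn, List.sum_ofFn]
    rfl
  rw [hloaded, State.size, sum_map_eq_sum_get, tokenLoad, ← Finset.sum_add_distrib]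
  exact Finset.sum_congr rfl fun i _ =>
    Request.size_afterLoad_add (hπ i).2.1 ((hπ i).2.2.trans (hvalid i))

lemma size_add_sum_le_size_step_add {ρ : ℝ} (ht : ∀ k ≤ b, 1 ≤ t k)
    (hρ : ∀ k ≤ b, (k : ℝ) ≤ ρ * t k) {x : State F} (hx : x.Valid)
    (hπ : x.remaining = 0 → IsFeasible π x ∧ tokenLoad π x ≤ b)
    (new : List (Request F)) :
    x.size + ρ * x.remaining + ((new.map Request.size).sum : ℕ) ≤
      (step t π x new).size + ρ * ((step t π x new).remaining + 1) := by
  by_cases hR : x.remaining = 0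
  · obtain ⟨hfeas, hload⟩ := hπ hR
    have hrate := hρ _ hload
    obtain ⟨s, hs⟩ := Nat.exists_eq_add_of_le' (ht _ hload)
    have hsize : (step t π x new).size =
        ((loadedQueue π x).map Request.size).sum + (new.map Request.size).sum := by
      simp only [step, hR, if_true, State.size, List.map_append, List.sum_append]
      rfl
    have hremaining : (step t π x new).remaining = s := by simp [step, hR, hs]
    rw [← hfeas.sum_size_loadedQueue_add hx, hsize, hremaining, hR]
    rw [hs] at hrate
    push_cast at hrate ⊢
    linarith
  · obtain ⟨r, hr⟩ := Nat.exists_eq_succ_of_ne_zero hR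
    have hsize : (step t π x new).size = x.size + (new.map Request.size).sum := by
      simp only [step, hR, if_false, State.size, List.map_append, List.sum_append]
      rfl
    have hremaining : (step t π x new).remaining = r := by simp [step, hr]
    rw [hsize, hremaining, hr]
    push_cast
    linarith

lemma remaining_step_le {T : ℕ} (ht : ∀ k ≤ b, t k ≤ T) {x : State F} {R : ℕ}
    (hx : x.remaining ≤ R) (hTR : T ≤ R) (hπ : x.remaining = 0 → tokenLoad π x ≤ b)
    (new : List (Request F)) : (step t π x new).remaining ≤ R := by
  by_cases hR : x.remaining = 0
  · have := ht _ (hπ hR)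
    simp only [step, hR, if_true]
    omega
  · simp only [step, hR, if_false]
    omega

lemma sum_size_arrivals (n : ℕ) (ω : Ω) :
    ∑ k ∈ Finset.range n, ((arrivals a vp vd z k ω).map Request.size).sum =
      ∑ i ∈ Finset.range (∑ k ∈ Finset.range n, a k ω), (vp i ω + vd i ω) := by
  rw [← sum_map_history (arrivals a vp vd z) ω fun l => (l.map Request.size).sum,
    arrivals_eq_blocks]
  refine Eq.trans ?_ (sum_map_history (request vp vd z) ω Request.size _)
  rw [← flatten_history_blocks, List.map_flatten, List.sum_flatten, List.map_map]
  rfl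

lemma remaining_chain_le {T : ℕ} (ht : ∀ k ≤ b, t k ≤ T) {x : State F} {ω : Ω}
    (hπ : ∀ n, (chain t π a vp vd z x n ω).remaining = 0 →
      tokenLoad π (chain t π a vp vd z x n ω) ≤ b) (n : ℕ) :
    (chain t π a vp vd z x n ω).remaining ≤ x.remaining + T := by
  induction n with
  | zero => exact Nat.le_add_right _ _
  | succ n ih => exact remaining_step_le ht ih (Nat.le_add_left _ _) (hπ n) _

lemma sum_size_arrivals_le (hvd : ∀ i ω, 1 ≤ vd i ω) {ρ : ℝ} (hρ_nonneg : 0 ≤ ρ)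
    (ht : ∀ k ≤ b, 1 ≤ t k) (hρ : ∀ k ≤ b, (k : ℝ) ≤ ρ * t k) {x : State F} (hx : x.Valid)
    {ω : Ω} (hπ : ∀ n, (chain t π a vp vd z x n ω).remaining = 0 →
      IsFeasible π (chain t π a vp vd z x n ω) ∧ tokenLoad π (chain t π a vp vd z x n ω) ≤ b)
    (n : ℕ) :
    ((∑ k ∈ Finset.range n, ((arrivals a vp vd z k ω).map Request.size).sum : ℕ) : ℝ) ≤
      (chain t π a vp vd z x n ω).size +
        ρ * ((chain t π a vp vd z x n ω).remaining + n) := by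
  induction n with
  | zero =>
    rw [Finset.range_zero, Finset.sum_empty, Nat.cast_zero]
    positivity
  | succ n ih =>
    have hstep := size_add_sum_le_size_step_add ht hρ (valid_chain hvd hx n ω) (hπ n)
      (arrivals a vp vd z n ω)
    rw [Finset.sum_range_succ, Nat.cast_add, Nat.cast_add, Nat.cast_one]
    simp only [chain]
    linarith

lemma sum_sub_le_size_chain (hvd : ∀ i ω, 1 ≤ vd i ω) {ρ : ℝ} (hρ_nonneg : 0 ≤ ρ) {T : ℕ}
    (ht : ∀ k ≤ b, 1 ≤ t k ∧ t k ≤ T) (hρ : ∀ k ≤ b, (k : ℝ) ≤ ρ * t k) {x : State F}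
    (hx : x.Valid) {ω : Ω}
    (hπ : ∀ n, (chain t π a vp vd z x n ω).remaining = 0 →
      IsFeasible π (chain t π a vp vd z x n ω) ∧ tokenLoad π (chain t π a vp vd z x n ω) ≤ b)
    (n : ℕ) :
    (∑ i ∈ Finset.range (∑ k ∈ Finset.range n, a k ω), ((vp i ω : ℝ) + vd i ω)) - ρ * n -
      ρ * (x.remaining + T : ℕ) ≤ (chain t π a vp vd z x n ω).size := by
  have harrived := sum_size_arrivals_le hvd hρ_nonneg (fun k hk => (ht k hk).1) hρ hx hπ n
  have hremaining : ρ * ((chain t π a vp vd z x n ω).remaining : ℝ) ≤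
      ρ * (x.remaining + T : ℕ) := by
    gcongr
    exact remaining_chain_le (fun k hk => (ht k hk).2) (fun n h => (hπ n h).2) n
  rw [sum_size_arrivals] at harrived
  push_cast at harrived hremaining ⊢
  linarith

lemma tendsto_sum_range_sub_atTop {A : ℕ → ℕ} {w : ℕ → ℝ} {r m ρ : ℝ}
    (hA : Tendsto (fun n => (A n : ℝ) / n) atTop (nhds r))
    (hw : Tendsto (fun n : ℕ => (∑ i ∈ Finset.range n, w i) / n) atTop (nhds m))
    (hr : 0 < r) (hρ : ρ < r * m) (c : ℝ) :
    Tendsto (fun n : ℕ => (∑ i ∈ Finset.range (A n), w i) - ρ * n - c) atTop atTop := by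
  have hA_atTop : Tendsto A atTop atTop := by
    rw [← tendsto_natCast_atTop_iff (R := ℝ)]
    refine (hA.pos_mul_atTop hr tendsto_natCast_atTop_atTop).congr' ?_
    filter_upwards [eventually_ne_atTop 0] with n hn
    exact div_mul_cancel₀ _ (Nat.cast_ne_zero.2 hn)
  have hrate : Tendsto (fun n => (A n : ℝ) / n * ((∑ i ∈ Finset.range (A n), w i) / A n) - ρ)
      atTop (nhds (r * m - ρ)) := (hA.mul (hw.comp hA_atTop)).sub_const ρ
  refine (tendsto_atTop_add_const_right atTop (-c)
    (hrate.pos_mul_atTop (sub_pos.2 hρ) tendsto_natCast_atTop_atTop)).congr' ?_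
  filter_upwards [eventually_gt_atTop 0, hA_atTop.eventually_gt_atTop 0] with n hn hAn
  field_simp
  ring

variable [MeasurableSpace Ω] {μ : Measure Ω}

lemma ae_mem_stateSpace [Countable F] (μ : Measure Ω) (X : State F → ℕ → Ω → State F)
    (x₀ : State F) : ∀ᵐ ω ∂μ, ∀ n, X x₀ n ω ∈ stateSpace μ X x₀ := by
  have h (n : ℕ) (y : State F) (hy : y ∉ stateSpace μ X x₀) : ∀ᵐ ω ∂μ, X x₀ n ω ≠ y :=
    measure_eq_zero_iff_ae_notMem.1 (nonpos_iff_eq_zero.1 (not_lt.1 fun hn => hy ⟨n, hn⟩))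
  have h' : ∀ᵐ ω ∂μ, ∀ n y, y ∉ stateSpace μ X x₀ → X x₀ n ω ≠ y := by
    simpa only [ae_all_iff] using h
  filter_upwards [h'] with ω hω n
  exact by_contra fun hn => hω n _ hn rfl

theorem ae_tendsto_size_atTop [Countable F] (ht : ∀ k ≤ b, 1 ≤ t k)
    (hvd_pos : ∀ i ω, 1 ≤ vd i ω)
    (ha_indep : iIndepFun a μ) (ha_ident : ∀ n, IdentDistrib (a n) (a 0) μ μ)
    (hv_indep : iIndepFun (fun i ω => (vp i ω, vd i ω)) μ)
    (hv_ident : ∀ i, IdentDistrib (fun ω => (vp i ω, vd i ω)) (fun ω => (vp 0 ω, vd 0 ω)) μ μ)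
    (ha_int : Integrable (fun ω => (a 0 ω : ℝ)) μ)
    (hvp_int : Integrable (fun ω => (vp 0 ω : ℝ)) μ)
    (hvd_int : Integrable (fun ω => (vd 0 ω : ℝ)) μ)
    {ρ : ℝ} (hρ : ∀ k ≤ b, (k : ℝ) / t k ≤ ρ)
    (hload : ρ < (∫ ω, (a 0 ω : ℝ) ∂μ) * (∫ ω, (vp 0 ω : ℝ) ∂μ + ∫ ω, (vd 0 ω : ℝ) ∂μ))
    {x₀ : State F} (hx₀ : x₀.Valid)
    (hπ : IsSchedulingAlgorithm b π (stateSpace μ (chain t π a vp vd z) x₀)) :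
    ∀ᵐ ω ∂μ, Tendsto (fun n => (chain t π a vp vd z x₀ n ω).size) atTop atTop := by
  have hρ_nonneg : 0 ≤ ρ := by simpa using hρ 0 b.zero_le
  have hrate (k : ℕ) (hk : k ≤ b) : (k : ℝ) ≤ ρ * t k :=
    (div_le_iff₀ (Nat.cast_pos.2 (ht k hk))).1 (hρ k hk)
  have hT (k : ℕ) (hk : k ≤ b) : 1 ≤ t k ∧ t k ≤ (Finset.range (b + 1)).sup t :=
    ⟨ht k hk, Finset.le_sup (Finset.mem_range.2 (Nat.lt_succ_of_le hk))⟩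
  have ha_pos : 0 < ∫ ω, (a 0 ω : ℝ) ∂μ :=
    pos_of_mul_pos_left (hρ_nonneg.trans_lt hload) (by positivity)
  have hcast : Measurable fun n : ℕ => (n : ℝ) := measurable_of_countable _
  have hadd : Measurable fun p : ℕ × ℕ => (p.1 : ℝ) + p.2 := measurable_of_countable _
  have ha_lln := strong_law_ae_real (fun n ω => (a n ω : ℝ)) ha_int
    (fun i j hij => (ha_indep.indepFun hij).comp hcast hcast) fun n => (ha_ident n).comp hcast
  have hv_lln := strong_law_ae_real (fun n ω => (vp n ω : ℝ) + vd n ω) (hvp_int.add hvd_int)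
    (fun i j hij => (hv_indep.indepFun hij).comp hadd hadd) fun n => (hv_ident n).comp hadd
  rw [integral_add hvp_int hvd_int] at hv_lln
  filter_upwards [ha_lln, hv_lln, ae_mem_stateSpace μ (chain t π a vp vd z) x₀]
    with ω haω hvω hmem
  rw [← tendsto_natCast_atTop_iff (R := ℝ)]
  refine tendsto_atTop_mono (sum_sub_le_size_chain hvd_pos hρ_nonneg hT hrate hx₀
    fun n hR => hπ _ (hmem n) hR) ?_
  exact tendsto_sum_range_sub_atTop (by simpa using haω) hvω ha_pos hload _

end Transience

end LLMEngine

theorem theorem1_general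
    {Ω F : Type*} [MeasurableSpace Ω] (μ : Measure Ω) [IsProbabilityMeasure μ]
    [Finite F] [MeasurableSpace F] [MeasurableSingletonClass F]
    (b : ℕ) (t : ℕ → ℕ) (ht : ∀ k ≤ b, 1 ≤ t k)
    (a vp vd : ℕ → Ω → ℕ) (z : ℕ → Ω → F)
    (ha_meas : ∀ n, Measurable (a n)) (hvp_meas : ∀ i, Measurable (vp i))
    (hvd_meas : ∀ i, Measurable (vd i)) (hz_meas : ∀ i, Measurable (z i))
    (hvd_pos : ∀ i ω, 1 ≤ vd i ω)
    (ha_indep : iIndepFun a μ) (ha_ident : ∀ n, IdentDistrib (a n) (a 0) μ μ)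
    (hv_indep : iIndepFun (fun i ω => (vp i ω, vd i ω, z i ω)) μ)
    (hv_ident : ∀ i, IdentDistrib (fun ω => (vp i ω, vd i ω, z i ω))
      (fun ω => (vp 0 ω, vd 0 ω, z 0 ω)) μ μ)
    (hav_indep : IndepFun (fun ω n => a n ω) (fun ω i => (vp i ω, vd i ω, z i ω)) μ)
    (ha_int : Integrable (fun ω => (a 0 ω : ℝ)) μ)
    (hvp_int : Integrable (fun ω => (vp 0 ω : ℝ)) μ)
    (hvd_int : Integrable (fun ω => (vd 0 ω : ℝ)) μ)
    (hvd_sq : Integrable (fun ω => (vd 0 ω : ℝ) ^ 2) μ)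
    (lam mp md : ℝ) (hlam : lam = ∫ ω, (a 0 ω : ℝ) ∂μ)
    (hmp : mp = ∫ ω, (vp 0 ω : ℝ) ∂μ) (hmd : md = ∫ ω, (vd 0 ω : ℝ) ∂μ)
    (π : LLMEngine.Policy F) (x₀ : LLMEngine.State F) (hx₀ : x₀.Valid)
    (S : Set (LLMEngine.State F))
    (hS : S = LLMEngine.stateSpace μ (LLMEngine.chain t π a vp vd z) x₀)
    (hπ : LLMEngine.IsSchedulingAlgorithm b π S) :
    (lam * (mp + md) < (b : ℝ) / t b → LLMEngine.IsWorkConserving b π S →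
      LLMEngine.IsIrreducibleOn μ (LLMEngine.chain t π a vp vd z) S →
      LLMEngine.IsPositiveRecurrentOn μ (LLMEngine.chain t π a vp vd z) S) ∧
    (∀ ρ : ℝ, (∀ k ≤ b, (k : ℝ) / t k ≤ ρ) → ρ < lam * (mp + md) →
      ∀ᵐ ω ∂μ, Tendsto (fun n => (LLMEngine.chain t π a vp vd z x₀ n ω).size) atTop atTop) := by
  subst hlam hmp hmd hS
  have hpair : Measurable fun p : ℕ × ℕ × F => (p.1, p.2.1) := by fun_prop
  exact ⟨fun hload hwc hirr => LLMEngine.isPositiveRecurrentOn_of_isWorkConserving ht ha_meas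
      hvp_meas hvd_meas hz_meas hvd_pos ha_indep ha_ident hv_indep hv_ident hav_indep ha_int
      hvp_int hvd_int hvd_sq hload hx₀ hπ hwc hirr,
    fun ρ hρ hload => LLMEngine.ae_tendsto_size_atTop ht hvd_pos ha_indep ha_ident
      (hv_indep.comp _ fun _ => hpair) (fun i => (hv_ident i).comp hpair) ha_int hvp_int hvd_int
      hρ hload hx₀ hπ⟩

theorem theorem1
    {Ω F : Type*} [MeasurableSpace Ω] (μ : Measure Ω) [IsProbabilityMeasure μ]
    [Finite F] [MeasurableSpace F] [MeasurableSingletonClass F]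
    -- token budget and batch processing times
    (b : ℕ) (hb : 1 ≤ b) (t : ℕ → ℕ) (ht : ∀ k ≤ b, 1 ≤ t k)
    -- numbers of arrivals; prefill tokens, decode tokens and features of the requests
    (a vp vd : ℕ → Ω → ℕ) (z : ℕ → Ω → F)
    (ha_meas : ∀ n, Measurable (a n)) (hvp_meas : ∀ i, Measurable (vp i))
    (hvd_meas : ∀ i, Measurable (vd i)) (hz_meas : ∀ i, Measurable (z i))
    (hvp_pos : ∀ i ω, 1 ≤ vp i ω) (hvd_pos : ∀ i ω, 1 ≤ vd i ω)
    -- two i.i.d. sequences that are independent of each other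
    (ha_indep : iIndepFun a μ) (ha_ident : ∀ n, IdentDistrib (a n) (a 0) μ μ)
    (hv_indep : iIndepFun (fun i ω => (vp i ω, vd i ω, z i ω)) μ)
    (hv_ident : ∀ i, IdentDistrib (fun ω => (vp i ω, vd i ω, z i ω))
      (fun ω => (vp 0 ω, vd 0 ω, z 0 ω)) μ μ)
    (hav_indep : IndepFun (fun ω n => a n ω) (fun ω i => (vp i ω, vd i ω, z i ω)) μ)
    -- moment assumptions
    (ha_int : Integrable (fun ω => (a 0 ω : ℝ)) μ)
    (hvp_int : Integrable (fun ω => (vp 0 ω : ℝ)) μ)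
    (hvd_int : Integrable (fun ω => (vd 0 ω : ℝ)) μ)
    (hvd_sq : Integrable (fun ω => (vd 0 ω : ℝ) ^ 2) μ)
    (lam mp md : ℝ) (hlam : lam = ∫ ω, (a 0 ω : ℝ) ∂μ)
    (hmp : mp = ∫ ω, (vp 0 ω : ℝ) ∂μ) (hmd : md = ∫ ω, (vd 0 ω : ℝ) ∂μ) :
    (lam * (mp + md) < (b : ℝ) / t b →
      ∀ (Kp Kd : ℕ), 1 ≤ Kp → 1 ≤ Kd →
      ∀ (π : LLMEngine.Policy F) (x₀ : LLMEngine.State F) (S : Set (LLMEngine.State F)),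
        x₀.Valid →
        S = LLMEngine.stateSpace μ (LLMEngine.chain t π a vp vd z) x₀ →
        LLMEngine.IsSchedulingAlgorithm b π S →
        LLMEngine.IsWorkConserving b π S →
        LLMEngine.IsFCFS Kp Kd π S →
        LLMEngine.IsIrreducibleOn μ (LLMEngine.chain t π a vp vd z) S →
        LLMEngine.IsPositiveRecurrentOn μ (LLMEngine.chain t π a vp vd z) S) ∧
    (lam * (mp + md) > (b : ℝ) / t b →
      -- the full batch has the largest token processing rate
      (∀ k ≤ b, (k : ℝ) / t k ≤ (b : ℝ) / t b) →
      ∀ (π : LLMEngine.Policy F) (x₀ : LLMEngine.State F),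
        x₀.Valid →
        LLMEngine.IsSchedulingAlgorithm b π
          (LLMEngine.stateSpace μ (LLMEngine.chain t π a vp vd z) x₀) →
        ∀ᵐ ω ∂μ, Tendsto (fun n => (LLMEngine.chain t π a vp vd z x₀ n ω).size) atTop atTop) := by
  have general := theorem1_general μ b t ht a vp vd z ha_meas hvp_meas hvd_meas hz_meas hvd_pos
    ha_indep ha_ident hv_indep hv_ident hav_indep ha_int hvp_int hvd_int hvd_sq lam mp md hlam
    hmp hmd
  exact ⟨fun hload _ _ _ _ π x₀ S hx₀ hS hπ hwc _ => (general π x₀ hx₀ S hS hπ).1 hload hwc,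
    fun hload hmax π x₀ hx₀ hπ => (general π x₀ hx₀ _ rfl hπ).2 _ hmax hload⟩
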